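/- Conventions. Modules are unitary. The socle $S(Q)$ of a module $Q$ is the submodule generated by all simple submodules; $Q$ is \emph{cocyclic} if $S(Q)$ is a (non-zero) simple essential submodule of $Q$. For finitely generated $Q$, $\mathrm{gen}(Q)$ is the smallest number of generators of $Q$. The socle series is $S_0(Q)=0$, $S_{m+1}(Q)/S_m(Q)=S(Q/S_m(Q))$, and $Q$ has socle length $m$ if $m$ is least with $S_m(Q)=Q$. Let $p$ be a prime. Let $N=\mathbb Z_{p^\infty}[x^{-1}]$ be the $\mathbb Z[x]$-module of all finitely supported sequences $a:\mathbb N\to\mathbb Z_{p^\infty}$ with $(xa)(n)=a(n+1)$. For $m\ge 1$ let $P_m$ be the $\mathbb Z[x]$-module with additive group $\mathbb Z_{p^m}\times\mathbb Z_{p^{m-1}}\times\dots\times\mathbb Z_p$ and $(xa)(n)=p\,a(n+1)$ for $0\le n\le m-2$, $(xa)(m-1)=0$; let $P_{m,1}$ be the $\mathbb Z[x]$-module with the same additive group on which $x$ acts as $a\mapsto xa-a$ (with $xa$ computed in $P_m$). Let $R_2=\mathbb Z[x,x^{-1},(1-x)^{-1}]$. If $p\ne 2$, then $x$ and $1-x$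 act bijectively on $P_{m,1}$, and $P'_{m,1}$ denotes $P_{m,1}$ with the resulting unique $R_2$-module structure. \textbf{Proposition.} Let $p$ be a prime. (A) Let $Q$ be a finitely generated cocyclic $\mathbb Z[x]$-module with $S(Q)\simeq P_1$ and let $k=\mathrm{gen}(Q)$. (i) If $k=1$ then $|Q|\ge p$, and if $|Q|=p$ then $Q\simeq S_1(N)\simeq P_1$. (ii) If $k=2$ then $|Q|\ge p^3$, and if $|Q|=p^3$ then $Q\simeq S_2(N)\simeq P_2$. (iii) If $k=3$ then $|Q|\ge p^6$, and if $|Q|=p^6$ and $Q$ is not isomorphic to $S_3(N)$ then the socle length of $Q$ is $4$. (iv) If $k\ge 4$ then $|Q|\ge p^7$. (B) Let $Q$ be a finitely generated cocyclic $\mathbb Z[x]$-module with $S(Q)\simeq P_{1,1}$ and let $k=\mathrm{gen}(Q)$. If $k\ge 3$ then $|Q|\ge p^6$; if $k\ge 4$ then $|Q|\ge p^7$. (C) Let $p\ne 2$, let $Q$ be a finitely generated cocyclic $R_2$-module with $S(Q)\simeq P'_{1,1}$ and let $k=\mathrm{gen}(Q)$. If $k\ge 3$ then $|Q|\ge p^6$;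 if $k\ge 4$ then $|Q|\ge p^7$. -/

import Mathlib

open Polynomial

namespace CocyclicModules

/-! ### Socles, socle series, cocyclic modules, number of generators -/

section Socle

/-- The socle of a module: the submodule generated by all simple submodules. -/
def socle (R M : Type*) [Ring R] [AddCommGroup M] [Module R M] : Submodule R M :=
  sSup {N : Submodule R M | IsSimpleModule R N}

/-- The (finite part of the) socle series: `S₀(M) = 0` and `Sₖ₊₁(M) / Sₖ(M) = Soc (M / Sₖ(M))`. -/
def socleSeries (R M : Type*) [Ring R] [AddCommGroup M] [Module R M] : ℕ → Submodule R M
  | 0 => ⊥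
  | k + 1 => (socle R (M ⧸ socleSeries R M k)).comap (socleSeries R M k).mkQ

/-- `M` has (finite) socle length `k`: `k` is the least index with `Sₖ(M) = M`. -/
def HasSocleLength (R M : Type*) [Ring R] [AddCommGroup M] [Module R M] (k : ℕ) : Prop :=
  IsLeast {j : ℕ | socleSeries R M j = ⊤} k

/-- A module is cocyclic if its socle is a (non-zero) simple submodule which is essential, i.e.
meets every non-zero submodule non-trivially. -/
def IsCocyclic (R M : Type*) [Ring R] [AddCommGroup M] [Module R M] : Prop :=
  IsSimpleModule R (socle R M) ∧ ∀ N : Submodule R M, N ≠ ⊥ → socle R M ⊓ N ≠ ⊥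

/-- The smallest number of generators of a finitely generated module. -/
noncomputable def gen (R M : Type*) [Ring R] [AddCommGroup M] [Module R M] : ℕ :=
  (⊤ : Submodule R M).spanFinrank

end Socle

/-! ### Modules of divided powers and the module `ℤ_{p^∞}[x⁻¹]` -/

section DividedPowers

/-- The shift `a ↦ (n ↦ a (n + 1))` on finitely supported sequences. -/
noncomputable def seqShift (R M : Type*) [CommRing R] [AddCommGroup M] [Module R M] :
    (ℕ →₀ M) →ₗ[R] (ℕ →₀ M) :=
  Finsupp.lcomapDomain (fun n : ℕ => n + 1) (add_left_injective 1)

/-- The module of divided powers `M[x⁻¹]`, as a module over `R[x]`: finitely supported sequences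
in `M`, on which `x` acts as the shift. -/
abbrev DividedPowers (R M : Type*) [CommRing R] [AddCommGroup M] [Module R M] : Type _ :=
  Module.AEval' (seqShift R M)

theorem seqShift_pow_apply (R M : Type*) [CommRing R] [AddCommGroup M] [Module R M]
    (i : ℕ) (a : ℕ →₀ M) (n : ℕ) : ((seqShift R M) ^ i) a n = a (n + i) := by
  induction i generalizing a with
  | zero => simp
  | succ i ih =>
    rw [pow_succ, Module.End.mul_apply, ih]
    simp [seqShift, add_assoc]

/-- The scalar multiplication of `M[x⁻¹]` is `(f a)(n) = ∑ fᵢ a(n + i)`. -/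
theorem dividedPowers_smul_apply (R M : Type*) [CommRing R] [AddCommGroup M] [Module R M]
    (f : R[X]) (a : ℕ →₀ M) (n : ℕ) :
    (Module.AEval'.of (seqShift R M)).symm (f • Module.AEval'.of (seqShift R M) a) n
      = f.sum fun i r => r • a (n + i) := by
  have h : (Module.AEval'.of (seqShift R M)).symm (f • Module.AEval'.of (seqShift R M) a)
      = aeval (seqShift R M) f a := by
    rw [LinearEquiv.symm_apply_eq]; rfl
  rw [h, aeval_eq_sum_range, Polynomial.sum_over_range _ (fun i => zero_smul R (a (n + i)))]
  simp [LinearMap.sum_apply, Finsupp.finsetSum_apply, seqShift_pow_apply]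

/-- The Prüfer group `ℤ_{p^∞} = ℤ[1/p] / ℤ`. -/
abbrev Pruefer (p : ℕ) : Type :=
  Localization.Away (p : ℤ) ⧸ (Int.castAddHom (Localization.Away (p : ℤ))).range

/-- The `ℤ[x]`-module `N = ℤ_{p^∞}[x⁻¹]`. -/
abbrev PrueferDividedPowers (p : ℕ) : Type :=
  DividedPowers ℤ (Pruefer p)

end DividedPowers

/-! ### The modules `Pₘ`, `Pₘ,₁` and `P'ₘ,₁` -/

section PModules

/-- Multiplication by `p` as a map `ℤ/pᵃ → ℤ/pᵇ`, `u mod pᵃ ↦ p u mod pᵇ`, for `b ≤ a + 1`. -/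
def mulP (p a b : ℕ) (h : b ≤ a + 1) : ZMod (p ^ a) →+ ZMod (p ^ b) :=
  ZMod.lift (p ^ a) ⟨zmultiplesHom (ZMod (p ^ b)) (p : ZMod (p ^ b)), by
    have h0 : ((p ^ (a + 1) : ℕ) : ZMod (p ^ b)) = 0 :=
      (ZMod.natCast_eq_zero_iff _ _).2 (pow_dvd_pow p h)
    have h1 : ((p ^ a : ℕ) : ZMod (p ^ b)) * (p : ZMod (p ^ b)) = 0 := by
      rw [← h0]; push_cast; ring
    simpa using h1⟩

theorem mulP_intCast (p a b : ℕ) (h : b ≤ a + 1) (u : ℤ) :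
    mulP p a b h (u : ZMod (p ^ a)) = ((p * u : ℤ) : ZMod (p ^ b)) := by
  simp [mulP, mul_comm]

/-- The group `ℤ/pᵐ × ℤ/pᵐ⁻¹ × ⋯ × ℤ/p`. -/
abbrev PGroup (p m : ℕ) : Type := (i : Fin m) → ZMod (p ^ (m - (i : ℕ)))

/-- The endomorphism `a ↦ (p a(1), p a(2), …, p a(m-1), 0)` of `ℤ/pᵐ × ℤ/pᵐ⁻¹ × ⋯ × ℤ/p`. -/
def pShift (p m : ℕ) : PGroup p m →ₗ[ℤ] PGroup p m :=
  AddMonoidHom.toIntLinearMap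
    { toFun := fun a n =>
        if h : (n : ℕ) + 1 < m then
          mulP p (m - ((n : ℕ) + 1)) (m - (n : ℕ)) (by omega) (a ⟨(n : ℕ) + 1, h⟩)
        else 0
      map_zero' := by ext n; simp
      map_add' := fun a b => by
        ext n
        by_cases h : (n : ℕ) + 1 < m <;> simp [h] }

theorem pShift_apply (p m : ℕ) (a : PGroup p m) (n : Fin m) :
    pShift p m a n = if h : (n : ℕ) + 1 < m then
      mulP p (m - ((n : ℕ) + 1)) (m - (n : ℕ)) (by omega) (a ⟨(n : ℕ) + 1, h⟩) else 0 := rfl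

/-- The `ℤ[x]`-module `Pₘ`: the group `ℤ/pᵐ × ⋯ × ℤ/p` with `x a = (p a(1), …, p a(m-1), 0)`. -/
abbrev P (p m : ℕ) : Type := Module.AEval' (pShift p m)

/-- The `ℤ[x]`-module `Pₘ,₁`: the group `ℤ/pᵐ × ⋯ × ℤ/p` with
`x · a = (p a(1), …, p a(m-1), 0) - a`. -/
abbrev P₁ (p m : ℕ) : Type := Module.AEval' (pShift p m - 1)

/-- The multiplicative subset of `ℤ[x]` generated by `x` and `1 - x`. -/
noncomputable abbrev R₂Denom : Submonoid ℤ[X] := Submonoid.closure {X, 1 - X}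

/-- The ring `R₂ = ℤ[x, x⁻¹, (1-x)⁻¹]`. -/
abbrev R₂ : Type := Localization R₂Denom

/-- The `R₂`-module `P'ₘ,₁` for `p` an odd prime: the `ℤ[x]`-module `Pₘ,₁`, made into an
`R₂`-module. It is realised as the localization of `Pₘ,₁`; since `x` and `1 - x` act bijectively
on `Pₘ,₁`, the localization map `Pₘ,₁ → P'ₘ,₁` is bijective, see `mkLinearMap_P₁_bijective`. -/
abbrev P₁' (p m : ℕ) : Type := LocalizedModule R₂Denom (P₁ p m)

theorem pShift_pow_apply_eq_zero (p m k : ℕ) (a : PGroup p m) (n : Fin m) (h : m ≤ n + k) :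
    ((pShift p m) ^ k) a n = 0 := by
  induction k generalizing n with
  | zero => exact absurd n.2 (by omega)
  | succ k ih =>
    rw [pow_succ', Module.End.mul_apply]
    by_cases h' : (n : ℕ) + 1 < m
    · rw [pShift_apply, dif_pos h', ih ⟨(n : ℕ) + 1, h'⟩ (by simp only; omega), map_zero]
    · rw [pShift_apply, dif_neg h']

theorem isNilpotent_pShift (p m : ℕ) : IsNilpotent (pShift p m) :=
  ⟨m, LinearMap.ext fun a => funext fun n => pShift_pow_apply_eq_zero p m m a n (by omega)⟩

theorem isUnit_two_PGroup (p m : ℕ) (hp : p.Prime) (h2 : p ≠ 2) :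
    IsUnit (2 : Module.End ℤ (PGroup p m)) := by
  have hc : IsCoprime (2 : ℤ) ((p : ℤ) ^ m) := by
    have : Nat.Coprime 2 (p ^ m) :=
      Nat.Coprime.pow_right m ((Nat.coprime_primes Nat.prime_two hp).2 h2.symm)
    exact_mod_cast Nat.isCoprime_iff_coprime.2 this
  obtain ⟨u, v, huv⟩ := hc
  have hz : ((p : Module.End ℤ (PGroup p m)) ^ m) = 0 := by
    have h0 : ((p ^ m : ℕ) : Module.End ℤ (PGroup p m)) = 0 := by
      refine LinearMap.ext fun a => funext fun n => ?_
      have h1 : ((p ^ m : ℕ) : ZMod (p ^ (m - (n : ℕ)))) = 0 :=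
        (ZMod.natCast_eq_zero_iff _ _).2 (pow_dvd_pow p (Nat.sub_le _ _))
      rw [Module.End.natCast_apply]
      simp only [Pi.smul_apply, nsmul_eq_mul, h1, zero_mul, LinearMap.zero_apply, Pi.zero_apply]
    exact_mod_cast h0
  have hu : (u : Module.End ℤ (PGroup p m)) * 2 = 1 := by
    have := congrArg (Int.cast : ℤ → Module.End ℤ (PGroup p m)) huv
    push_cast at this
    rwa [hz, mul_zero, add_zero] at this
  have hu' : 2 * (u : Module.End ℤ (PGroup p m)) = 1 := by
    rw [← hu]; exact ((Int.cast_commute u (2 : Module.End ℤ (PGroup p m))).eq).symm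
  exact ⟨⟨2, u, hu', hu⟩, rfl⟩

theorem smul_bijective_P₁ (p m : ℕ) (hp : p.Prime) (h2 : p ≠ 2) (s : ℤ[X]) (hs : s ∈ R₂Denom) :
    Function.Bijective (fun a : P₁ p m => s • a) := by
  have key : ∀ f : ℤ[X], IsUnit (aeval (pShift p m - 1) f) →
      Function.Bijective (fun a : P₁ p m => f • a) := fun f hf =>
    (Module.End.isUnit_iff (aeval (pShift p m - 1) f)).1 hf
  refine key s ?_
  have hn := isNilpotent_pShift p m
  induction hs using Submonoid.closure_induction with
  | mem x hx =>
    rcases hx with rfl | rfl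
    · rw [aeval_X]
      exact hn.isUnit_sub_one
    · have h3 : aeval (pShift p m - 1) (1 - X : ℤ[X]) = -(pShift p m) + 2 := by
        rw [map_sub, aeval_X, map_one, ← one_add_one_eq_two]; abel
      rw [h3]
      exact hn.neg.isUnit_add_right_of_commute (isUnit_two_PGroup p m hp h2)
        (Nat.commute_cast _ 2)
  | one => rw [map_one]; exact isUnit_one
  | mul x y _ _ hx hy => rw [map_mul]; exact hx.mul hy

/-- For an odd prime `p`, the localization map `Pₘ,₁ → P'ₘ,₁` is bijective. -/
theorem mkLinearMap_P₁_bijective (p m : ℕ) (hp : p.Prime) (h2 : p ≠ 2) :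
    Function.Bijective (LocalizedModule.mkLinearMap R₂Denom (P₁ p m)) := by
  refine ⟨(injective_iff_map_eq_zero _).2 fun a ha => ?_, fun b => ?_⟩
  · obtain ⟨s, hs⟩ := (IsLocalizedModule.eq_zero_iff R₂Denom _).1 ha
    exact (smul_bijective_P₁ p m hp h2 s s.2).1 (by simpa [Submonoid.smul_def] using hs)
  · induction b using LocalizedModule.induction_on with
    | _ a s =>
      obtain ⟨c, hc⟩ := (smul_bijective_P₁ p m hp h2 s s.2).2 a
      refine ⟨c, ?_⟩
      rw [LocalizedModule.mkLinearMap_apply, ← hc]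
      exact (LocalizedModule.mk_cancel s c).symm

end PModules

end CocyclicModules

open CocyclicModules

/-! Let the socle be killed by `p` and by `b`, where `b` is `x` for `P₁`, and `x + 1` for `P₁,₁` and
`P'₁,₁`. In all three cases the residue ring modulo `(p, b)` is represented by integers, so the
socle has order `p` and consists of all elements killed by `p` and `b`. Since Q is Noetherian and
its socle is essential, a Fitting argument makes `p` and `b` nilpotent on Q
(`exists_pow_smul_eq_zero`).

Put `a = p` and let `Tₖ` be the set of elements killed by all monomials of degree `k` in `a, b`.
Applying the `k + 1` monomials of degree `k` embeds `Tₖ₊₁ / Tₖ` into `T₁ ^ (k + 1)`, so `|Tₖ|` is at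
most `p ^ (k (k + 1) / 2)`.

Many generators force equality for small `k`. For finite Q with `gen Q ≥ k + 1`, Nakayama gives
`|ker a| = |Q / aQ| ≥ p ^ (k + 1)`. On `ker a` the kernel of `b` has order `p`, so `b ^ k` does not
vanish there, and each `t` in `T₁` is `b ^ k v` with `a v = 0` (`exists_smul_eq_zero_pow_smul_eq`).
The same holds with `a, b` replaced by `b, a` or by `a + b, b`. Two such directions fill `T₂ / T₁`
and three fill `T₃ / T₂`, whence `|T₂| = p ^ 3` and `|T₃| = p ^ 6`. With four generators some `b ^ 3
v` is nonzero, so `T₃ ≠ Q` and `|Q| ≥ p ^ 7`.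

For socle `P₁` and minimal order, `Q = Tₖ`. A homomorphism `f` from Q to the Prüfer group that is
nonzero on the socle gives the embedding `q ↦ (f(q), f(xq), …)` into `N`. It lands in `Sₖ(N)`, whose
order is at most `|Q|`, so it is an isomorphism onto `Sₖ(N)`. This covers `k = 3` as well: the
exceptional modules of socle length 4 in (A)(iii) do not exist, and that clause holds vacuously. -/

namespace CocyclicModules

/-! ### Orders of kernels of powers -/

section Counting

theorem natCard_eq_ker_mul_range {G H : Type*} [AddCommGroup G] [AddCommGroup H] (f : G →+ H) :
    Nat.card G = Nat.card f.ker * Nat.card f.range := by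
  rw [← AddSubgroup.index_ker, AddSubgroup.card_mul_index]

/-- `f ^ n` maps the kernel of `f ^ (n + 1)` into the kernel of `f`, and what it kills lies in the
kernel of `f ^ n`. -/
theorem natCard_ker_pow_le {M : Type*} [AddCommGroup M] [Finite M] (f : AddMonoid.End M) (n : ℕ) :
    Nat.card {q : M // (f ^ n) q = 0} ≤ Nat.card {q : M // f q = 0} ^ n := by
  induction n with
  | zero => simp [Nat.card_eq_fintype_card]
  | succ n ih =>
    let g : (f ^ (n + 1) : M →+ M).ker →+ M := (f ^ n : M →+ M).comp (AddSubgroup.subtype _)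
    have h1 := natCard_eq_ker_mul_range g
    have h2 : Nat.card g.ker ≤ Nat.card {q : M // (f ^ n) q = 0} :=
      Nat.card_le_card_of_injective (fun q => ⟨q.1.1, q.2⟩) fun q r h =>
        Subtype.ext (Subtype.ext (Subtype.mk.inj h))
    have h3 : Nat.card g.range ≤ Nat.card {q : M // f q = 0} := by
      refine Nat.card_le_card_of_injective (fun q => ⟨q.1, ?_⟩) fun q r h =>
        Subtype.ext (Subtype.mk.inj h)
      obtain ⟨q, ⟨⟨r, hr⟩, rfl⟩⟩ := q
      have : (f ^ (n + 1)) r = 0 := hr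
      rw [pow_succ'] at this
      exact this
    calc Nat.card {q : M // (f ^ (n + 1)) q = 0} = _ := h1
      _ ≤ _ := Nat.mul_le_mul (h2.trans ih) h3
      _ = _ := (pow_succ _ _).symm

end Counting

/-! ### The filtration by monomials in two ring elements -/

section TorsionFiltration

variable {R : Type*} [CommRing R]

/-- The submodule of all elements killed by all monomials of degree `k` in `a` and `b`. -/
def torsionFiltration (a b : R) (M : Type*) [AddCommGroup M] [Module R M] : ℕ → Submodule R M
  | 0 => ⊥
  | k + 1 => (torsionFiltration a b M k).comap (LinearMap.lsmul R M a) ⊓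
      (torsionFiltration a b M k).comap (LinearMap.lsmul R M b)

variable {a b : R} {M : Type*} [AddCommGroup M] [Module R M]

@[simp] theorem mem_torsionFiltration_zero {q : M} : q ∈ torsionFiltration a b M 0 ↔ q = 0 :=
  Submodule.mem_bot R

theorem mem_torsionFiltration_succ {k : ℕ} {q : M} : q ∈ torsionFiltration a b M (k + 1) ↔
    a • q ∈ torsionFiltration a b M k ∧ b • q ∈ torsionFiltration a b M k := Iff.rfl

theorem mem_torsionFiltration_one {q : M} : q ∈ torsionFiltration a b M 1 ↔
    a • q = 0 ∧ b • q = 0 := by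
  rw [mem_torsionFiltration_succ, mem_torsionFiltration_zero, mem_torsionFiltration_zero]

/-- The case `j = 0` describes the filtration by monomials; the case `j = 1` makes `monomialMap`
take values in the first step. -/
theorem mem_torsionFiltration_add {j k : ℕ} {q : M} : q ∈ torsionFiltration a b M (k + j) ↔
    ∀ i ≤ k, (a ^ i * b ^ (k - i)) • q ∈ torsionFiltration a b M j := by
  induction k generalizing q with
  | zero => simp
  | succ k ih =>
    rw [add_right_comm, mem_torsionFiltration_succ, ih, ih]
    constructor
    · rintro ⟨h1, h2⟩ i hi
      obtain _ | i := i
      · have := h2 0 (Nat.zero_le _)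
        rwa [smul_smul, pow_zero, one_mul, Nat.sub_zero, ← pow_succ, ← one_mul (b ^ (k + 1)),
          ← pow_zero a] at this
      · have := h1 i (by omega)
        rwa [smul_smul, mul_right_comm, ← pow_succ, ← Nat.add_sub_add_right k 1 i] at this
    · intro h
      refine ⟨fun i hi => ?_, fun i hi => ?_⟩
      · have := h (i + 1) (by omega)
        rwa [smul_smul, mul_right_comm, ← pow_succ, ← Nat.add_sub_add_right k 1 i]
      · have := h i (by omega)
        rwa [smul_smul, mul_assoc, ← pow_succ, ← Nat.sub_add_comm hi]

theorem torsionFiltration_le_succ (k : ℕ) :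
    torsionFiltration a b M k ≤ torsionFiltration a b M (k + 1) := fun _ hq =>
  mem_torsionFiltration_succ.2 ⟨Submodule.smul_mem _ _ hq, Submodule.smul_mem _ _ hq⟩

/-- The map sending `q` to the images of `q` under the monomials of degree `k` in `a` and `b`. -/
def monomialMap (a b : R) (M : Type*) [AddCommGroup M] [Module R M] (k : ℕ) :
    torsionFiltration a b M (k + 1) →+ (Fin (k + 1) → torsionFiltration a b M 1) where
  toFun q i := ⟨(a ^ (i : ℕ) * b ^ (k - (i : ℕ))) • q.1,
    mem_torsionFiltration_add.1 q.2 i (Nat.lt_succ_iff.1 i.2)⟩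
  map_zero' := by ext; simp
  map_add' q r := by ext; simp

theorem mem_ker_monomialMap {k : ℕ} {q : torsionFiltration a b M (k + 1)} :
    q ∈ (monomialMap a b M k).ker ↔ q.1 ∈ torsionFiltration a b M k := by
  have h := mem_torsionFiltration_add (a := a) (b := b) (j := 0) (k := k) (q := q.1)
  rw [add_zero] at h
  rw [h, AddMonoidHom.mem_ker, funext_iff]
  simp only [mem_torsionFiltration_zero]
  refine ⟨fun h i hi => congrArg Subtype.val (h ⟨i, by omega⟩),
    fun h i => Subtype.ext (h i (Nat.lt_succ_iff.1 i.2))⟩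

/-- The kernel of `monomialMap a b M k` is the `k`-th step of the filtration. -/
def kerMonomialMapEquiv (a b : R) (M : Type*) [AddCommGroup M] [Module R M] (k : ℕ) :
    (monomialMap a b M k).ker ≃ torsionFiltration a b M k where
  toFun q := ⟨q.1.1, mem_ker_monomialMap.1 q.2⟩
  invFun q := ⟨⟨q.1, torsionFiltration_le_succ k q.2⟩, mem_ker_monomialMap.2 q.2⟩

theorem natCard_torsionFiltration_succ (k : ℕ) : Nat.card (torsionFiltration a b M (k + 1)) =
    Nat.card (torsionFiltration a b M k) * Nat.card (monomialMap a b M k).range := by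
  rw [natCard_eq_ker_mul_range (monomialMap a b M k),
    Nat.card_congr (kerMonomialMapEquiv a b M k)]

theorem natCard_torsionFiltration_succ_of_surjective {p k : ℕ}
    (h1 : Nat.card (torsionFiltration a b M 1) = p)
    (h : Function.Surjective (monomialMap a b M k)) :
    Nat.card (torsionFiltration a b M (k + 1)) =
      Nat.card (torsionFiltration a b M k) * p ^ (k + 1) := by
  rw [natCard_torsionFiltration_succ, AddMonoidHom.range_eq_top.2 h, AddSubgroup.card_top,
    Nat.card_pi]
  simp [h1]

theorem finite_torsionFiltration [Finite (torsionFiltration a b M 1)] (k : ℕ) :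
    Finite (torsionFiltration a b M k) := by
  induction k with
  | zero => exact inferInstanceAs (Finite (⊥ : Submodule R M))
  | succ k ih =>
    have : Finite (monomialMap a b M k).ker := Finite.of_equiv _ (kerMonomialMapEquiv a b M k).symm
    exact (monomialMap a b M k).finite_iff_finite_ker_range.2 ⟨this, inferInstance⟩

/-- Each successive quotient embeds by `monomialMap` into `k + 1` copies of the first step, and `1 +
2 + ⋯ + k = k (k + 1) / 2`. -/
theorem natCard_torsionFiltration_le {p : ℕ} [Finite (torsionFiltration a b M 1)]
    (h1 : Nat.card (torsionFiltration a b M 1) ≤ p) (k : ℕ) :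
    Nat.card (torsionFiltration a b M k) ≤ p ^ (k * (k + 1) / 2) := by
  induction k with
  | zero => exact (Nat.card_unique (α := (⊥ : Submodule R M))).le
  | succ k ih =>
    have h2 : Nat.card (monomialMap a b M k).range ≤ p ^ (k + 1) := by
      refine (Nat.card_le_card_of_injective _ Subtype.val_injective).trans ?_
      rw [Nat.card_pi]
      simpa using Nat.pow_le_pow_left h1 (k + 1)
    have h3 : (k + 1) * (k + 1 + 1) / 2 = k * (k + 1) / 2 + (k + 1) := by
      rw [← Nat.add_mul_div_right _ _ two_pos]; congr 1; ring
    rw [natCard_torsionFiltration_succ, h3, pow_add]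
    exact Nat.mul_le_mul ih h2

end TorsionFiltration

/-! ### Socle series and nilpotency -/

section Socle

variable {R : Type*} [CommRing R] {p : ℕ} {b : R}

/-- `(p, b)` is an ideal all of whose residue classes are represented by integers. -/
def HasIntResidues (p : ℕ) (b : R) : Prop :=
  ∀ r : R, ∃ n : ℤ, r - n ∈ Ideal.span {(p : R), b}

variable {M : Type*} [AddCommGroup M] [Module R M]

theorem smul_eq_zero_of_mem_span {q : M} (hq : q ∈ torsionFiltration (p : R) b M 1) {r : R}
    (hr : r ∈ Ideal.span {(p : R), b}) : r • q = 0 := by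
  obtain ⟨u, v, rfl⟩ := Ideal.mem_span_pair.1 hr
  obtain ⟨h1, h2⟩ := mem_torsionFiltration_one.1 hq
  rw [add_smul, mul_smul, mul_smul, h1, h2, smul_zero, smul_zero, add_zero]

theorem exists_zsmul_zsmul_eq {A : Type*} [AddCommGroup A] (hp : p.Prime) {q : A}
    (hq : (p : ℤ) • q = 0) {n : ℤ} (hn : n • q ≠ 0) : ∃ m : ℤ, m • n • q = q := by
  have hc : IsCoprime (p : ℤ) n := by
    refine ((Nat.prime_iff_prime_int.1 hp).irreducible.coprime_iff_not_dvd).2 ?_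
    rintro ⟨c, rfl⟩
    exact hn (by rw [mul_comm, mul_smul, hq, smul_zero])
  obtain ⟨u, v, huv⟩ := hc
  refine ⟨v, ?_⟩
  rw [smul_smul]
  nth_rw 2 [← one_zsmul q]
  rw [← huv, add_smul, mul_smul u, hq, smul_zero, zero_add]

theorem natCast_smul_eq_zero_iff {q : M} : (p : R) • q = 0 ↔ (p : ℤ) • q = 0 := by
  rw [Nat.cast_smul_eq_nsmul, natCast_zsmul]

theorem exists_zsmul_eq_smul (hR : HasIntResidues p b) {q : M}
    (hq : q ∈ torsionFiltration (p : R) b M 1) (r : R) : ∃ n : ℤ, r • q = n • q := by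
  obtain ⟨n, hn⟩ := hR r
  refine ⟨n, ?_⟩
  have := smul_eq_zero_of_mem_span hq hn
  rwa [sub_smul, sub_eq_zero, Int.cast_smul_eq_zsmul] at this

/-- The ring acts on the span of `q` through integers modulo `p`, so a nonzero multiple of `q` can
be scaled back to `q`. -/
theorem mem_span_singleton_symm (hp : p.Prime) (hR : HasIntResidues p b) {q : M}
    (hq : q ∈ torsionFiltration (p : R) b M 1) {s : M} (hs : s ∈ Submodule.span R {q})
    (hs0 : s ≠ 0) : ∃ n : ℤ, n • s = q := by
  obtain ⟨r, rfl⟩ := Submodule.mem_span_singleton.1 hs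
  obtain ⟨n, hn⟩ := exists_zsmul_eq_smul hR hq r
  rw [hn] at hs0 ⊢
  exact exists_zsmul_zsmul_eq hp (natCast_smul_eq_zero_iff.1 (mem_torsionFiltration_one.1 hq).1) hs0

theorem isSimpleModule_span_singleton (hp : p.Prime) (hR : HasIntResidues p b) {q : M}
    (hq : q ∈ torsionFiltration (p : R) b M 1) (hq0 : q ≠ 0) :
    IsSimpleModule R (Submodule.span R {q}) := by
  have : Nontrivial (Submodule.span R {q}) :=
    ⟨⟨⟨q, Submodule.mem_span_singleton_self q⟩, 0, fun h => hq0 (congrArg Subtype.val h)⟩⟩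
  refine isSimpleModule_iff_toSpanSingleton_surjective.2 ⟨this, fun s hs t => ?_⟩
  obtain ⟨n, hn⟩ := mem_span_singleton_symm hp hR hq s.2 fun h => hs (Subtype.ext h)
  obtain ⟨r, hr⟩ := Submodule.mem_span_singleton.1 t.2
  refine ⟨r * n, Subtype.ext ?_⟩
  rw [LinearMap.toSpanSingleton_apply, Submodule.coe_smul, mul_smul, Int.cast_smul_eq_zsmul, hn, hr]

/-- If `r q ≠ 0`, then no power of `r` kills `q`: when `r ^ n q ≠ 0`, simplicity gives `q = s r ^ n
q`, so `r ^ (n + 1) q = 0` would imply `r q = 0`. -/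
theorem smul_eq_zero_of_isSimpleModule {r : R} (hr : ∀ q : M, ∃ n : ℕ, r ^ n • q = 0)
    [IsSimpleModule R M] (q : M) : r • q = 0 := by
  by_contra h
  have key : ∀ n : ℕ, r ^ n • q ≠ 0 := by
    intro n
    induction n with
    | zero => intro h0; rw [pow_zero, one_smul] at h0; exact h (by rw [h0, smul_zero])
    | succ n ih =>
      intro h0
      obtain ⟨s, hs⟩ := IsSimpleModule.toSpanSingleton_surjective R ih q
      rw [LinearMap.toSpanSingleton_apply] at hs
      apply h
      rw [← hs, smul_comm, smul_smul r, ← pow_succ', h0, smul_zero]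
  obtain ⟨n, hn⟩ := hr q
  exact key n hn

theorem socle_eq_torsionFiltration_one (hp : p.Prime) (hR : HasIntResidues p b)
    (h1 : ∀ q : M, ∃ n : ℕ, (p : R) ^ n • q = 0) (h2 : ∀ q : M, ∃ n : ℕ, b ^ n • q = 0) :
    socle R M = torsionFiltration (p : R) b M 1 := by
  refine le_antisymm (sSup_le fun N (hN : IsSimpleModule R N) q hq => ?_) fun q hq => ?_
  · have key : ∀ r : R, (∀ q : M, ∃ n : ℕ, r ^ n • q = 0) → r • q = 0 := fun r hr =>
      congrArg Subtype.val (smul_eq_zero_of_isSimpleModule (M := N) (r := r)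
        (fun s => (hr s).imp fun n hn => Subtype.ext hn) ⟨q, hq⟩)
    exact mem_torsionFiltration_one.2 ⟨key _ h1, key _ h2⟩
  · by_cases hq0 : q = 0
    · rw [hq0]; exact Submodule.zero_mem _
    · exact (le_sSup (a := Submodule.span R {q}) (isSimpleModule_span_singleton hp hR hq hq0) :
        _ ≤ socle R M) (Submodule.mem_span_singleton_self q)

theorem socleSeries_eq_torsionFiltration (hp : p.Prime) (hR : HasIntResidues p b)
    (h1 : ∀ q : M, ∃ n : ℕ, (p : R) ^ n • q = 0) (h2 : ∀ q : M, ∃ n : ℕ, b ^ n • q = 0) (k : ℕ) :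
    socleSeries R M k = torsionFiltration (p : R) b M k := by
  induction k with
  | zero => rfl
  | succ k ih =>
    have hq : ∀ r : R, (∀ q : M, ∃ n : ℕ, r ^ n • q = 0) →
        ∀ q : M ⧸ socleSeries R M k, ∃ n : ℕ, r ^ n • q = 0 := fun r hr q => by
      obtain ⟨q, rfl⟩ := Submodule.mkQ_surjective _ q
      obtain ⟨n, hn⟩ := hr q
      exact ⟨n, by rw [← map_smul, hn, map_zero]⟩
    ext q
    rw [socleSeries, socle_eq_torsionFiltration_one hp hR (hq _ h1) (hq _ h2), Submodule.mem_comap,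
      mem_torsionFiltration_one, ← map_smul, ← map_smul, mem_torsionFiltration_succ, ← ih, Submodule.mkQ_apply,
      Submodule.mkQ_apply, Submodule.Quotient.mk_eq_zero, Submodule.Quotient.mk_eq_zero]

/-- Fitting: for large `n` the kernel and the range of `r ^ n` are disjoint. The socle lies in the
kernel as soon as the exponent is positive, which is why `n + 1` is used; a range missing an
essential socle is zero. -/
theorem exists_pow_smul_eq_zero [IsNoetherianRing R] [Module.Finite R M] (hM : IsCocyclic R M)
    {r : R} (hr : ∀ q ∈ socle R M, r • q = 0) : ∃ n : ℕ, ∀ q : M, r ^ n • q = 0 := by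
  obtain ⟨n, hn⟩ := Filter.eventually_atTop.1
    (Module.End.eventually_disjoint_ker_pow_range_pow (LinearMap.lsmul R M r))
  refine ⟨n + 1, fun q => ?_⟩
  have key : ∀ (m : ℕ) (q : M), (LinearMap.lsmul R M r ^ m) q = r ^ m • q := fun m q => by
    induction m generalizing q with
    | zero => simp
    | succ m ih => rw [pow_succ', Module.End.mul_apply, ih, LinearMap.lsmul_apply, smul_smul,
        pow_succ']
  by_contra h
  refine hM.2 (LinearMap.range (LinearMap.lsmul R M r ^ (n + 1)))
    (fun h0 => h ?_) (eq_bot_mono (inf_le_inf_right _ fun s hs => ?_)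
      (disjoint_iff.1 (hn (n + 1) (by omega))))
  · rw [← key]
    exact (Submodule.mem_bot R).1 (h0 ▸ LinearMap.mem_range_self _ q)
  · rw [LinearMap.mem_ker, key, pow_succ, mul_smul, hr s hs, smul_zero]

end Socle

/-! ### Numbers of generators and the size of the filtration -/

section Generators

variable {R : Type*} [CommRing R] {p : ℕ} {a b : R}
variable {M : Type*} [AddCommGroup M] [Module R M]

theorem natCard_submodule_dvd (N : Submodule R M) : Nat.card N ∣ Nat.card M :=
  AddSubgroup.card_addSubgroup_dvd_card N.toAddSubgroup

theorem mul_natCard_le_of_lt [Finite M] (hp : p.Prime) {m : ℕ} (hm : Nat.card M = p ^ m)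
    {N N' : Submodule R M} (h : N < N') : p * Nat.card N ≤ Nat.card N' := by
  obtain ⟨i, -, hi⟩ := (Nat.dvd_prime_pow hp).1 (hm ▸ natCard_submodule_dvd N)
  obtain ⟨j, -, hj⟩ := (Nat.dvd_prime_pow hp).1 (hm ▸ natCard_submodule_dvd N')
  have hlt : Nat.card N < Nat.card N' := Set.Finite.card_lt_card (Set.toFinite _) h
  rw [hi, hj] at hlt ⊢
  rw [← pow_succ']
  exact Nat.pow_le_pow_right hp.pos ((Nat.pow_lt_pow_iff_right hp.one_lt).1 hlt)

/-- Nakayama's lemma for a nilpotent `a`: iterating `M = aM + N` gives `M = a ^ j M + N` for every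
`j`. -/
theorem eq_top_of_range_lsmul_sup_eq_top {n : ℕ} (hn : ∀ q : M, a ^ n • q = 0) {N : Submodule R M}
    (h : LinearMap.range (LinearMap.lsmul R M a) ⊔ N = ⊤) : N = ⊤ := by
  have key : ∀ (j : ℕ) (q : M), ∃ r : M, q - a ^ j • r ∈ N := by
    intro j
    induction j with
    | zero => exact fun q => ⟨q, by simp⟩
    | succ j ih =>
      intro q
      obtain ⟨r, hr⟩ := ih q
      obtain ⟨_, ⟨s, rfl⟩, t, ht, hst⟩ := Submodule.mem_sup.1 (h ▸ Submodule.mem_top (x := r))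
      refine ⟨s, ?_⟩
      rw [LinearMap.lsmul_apply] at hst
      have : q - a ^ (j + 1) • s = (q - a ^ j • r) + a ^ j • t := by
        rw [← hst, smul_add, smul_smul, ← pow_succ]; abel
      rw [this]
      exact N.add_mem hr (N.smul_mem _ ht)
  refine eq_top_iff.2 fun q _ => ?_
  obtain ⟨r, hr⟩ := key n q
  rwa [hn, sub_zero] at hr

/-- Elements are added to `aM` one at a time. By Nakayama, fewer than `gen R M` of them never
suffice, so each of the first `k` additions can be made a strict enlargement, by a factor of at
least `p`. -/
theorem pow_mul_natCard_range_le [Finite M] (hp : p.Prime) {m : ℕ} (hm : Nat.card M = p ^ m)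
    {n : ℕ} (hn : ∀ q : M, a ^ n • q = 0) {k : ℕ} (hk : k ≤ gen R M) :
    p ^ k * Nat.card (LinearMap.range (LinearMap.lsmul R M a)) ≤ Nat.card M := by
  classical
  suffices H : ∀ k ≤ gen R M, ∃ s : Finset M, s.card ≤ k ∧
      p ^ k * Nat.card (LinearMap.range (LinearMap.lsmul R M a)) ≤
        Nat.card ↥(LinearMap.range (LinearMap.lsmul R M a) ⊔ Submodule.span R (s : Set M)) by
    obtain ⟨s, -, hs⟩ := H k hk
    exact hs.trans (Nat.card_le_card_of_injective _ Subtype.val_injective)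
  intro k
  induction k with
  | zero => exact fun _ => ⟨∅, by simp, by simp⟩
  | succ k ih =>
    intro hk
    obtain ⟨s, hs, hs'⟩ := ih (Nat.le_of_succ_le hk)
    have hne : LinearMap.range (LinearMap.lsmul R M a) ⊔ Submodule.span R (s : Set M) ≠ ⊤ := by
      intro h
      have h1 := eq_top_of_range_lsmul_sup_eq_top hn h
      have h2 := Submodule.spanFinrank_span_le_ncard_of_finite (R := R) (s.finite_toSet)
      rw [h1, Set.ncard_coe_finset] at h2
      exact absurd (hk.trans (h2.trans hs)) (by omega)
    obtain ⟨q, -, hq⟩ := SetLike.exists_of_lt (lt_top_iff_ne_top.2 hne)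
    refine ⟨insert q s, (Finset.card_insert_le _ _).trans (by omega), ?_⟩
    have hlt : LinearMap.range (LinearMap.lsmul R M a) ⊔ Submodule.span R (s : Set M) <
        LinearMap.range (LinearMap.lsmul R M a) ⊔
          Submodule.span R ((insert q s : Finset M) : Set M) := by
      refine lt_of_le_of_ne (sup_le_sup_left (Submodule.span_mono (by simp)) _) fun h => hq ?_
      rw [h]
      exact Submodule.mem_sup_right (Submodule.subset_span (by simp))
    rw [pow_succ', mul_assoc]
    exact (Nat.mul_le_mul_left p hs').trans (mul_natCard_le_of_lt hp hm hlt)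

/-- The kernel of `a` has the order of `M / aM`, at least `p ^ (k + 1)`, while the part of it killed
by `b ^ k` has order at most `p ^ k`. -/
theorem exists_smul_eq_zero_pow_smul_eq [Finite M] (hp : p.Prime) {m : ℕ}
    (hm : Nat.card M = p ^ m) (ha : ∃ n : ℕ, ∀ q : M, a ^ n • q = 0)
    (hb : ∃ n : ℕ, ∀ q : M, b ^ n • q = 0) (h1 : Nat.card (torsionFiltration a b M 1) = p)
    {k : ℕ} (hk : k + 1 ≤ gen R M) {t : M} (ht : t ∈ torsionFiltration a b M 1) :
    ∃ v : M, a • v = 0 ∧ b ^ k • v = t := by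
  obtain ⟨n, hn⟩ := ha
  have hcard : p ^ (k + 1) ≤ Nat.card (LinearMap.ker (LinearMap.lsmul R M a)) := by
    have h2 := pow_mul_natCard_range_le hp hm hn hk
    have h3 : Nat.card M = Nat.card (LinearMap.ker (LinearMap.lsmul R M a)) *
        Nat.card (LinearMap.range (LinearMap.lsmul R M a)) :=
      natCard_eq_ker_mul_range (LinearMap.lsmul R M a).toAddMonoidHom
    rw [h3] at h2
    exact Nat.le_of_mul_le_mul_right h2 Nat.card_pos
  let f : AddMonoid.End (LinearMap.ker (LinearMap.lsmul R M a)) :=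
    (LinearMap.lsmul R (LinearMap.ker (LinearMap.lsmul R M a)) b).toAddMonoidHom
  have hf : ∀ (j : ℕ) (q : LinearMap.ker (LinearMap.lsmul R M a)), (f ^ j) q = b ^ j • q := by
    intro j
    induction j with
    | zero => simp
    | succ j ih =>
      intro q
      rw [pow_succ', pow_succ', mul_smul, ← ih]
      rfl
  have hker : Nat.card {q // f q = 0} = p := by
    rw [← h1]
    refine Nat.card_congr ⟨fun q => ⟨q.1.1, mem_torsionFiltration_one.2
      ⟨q.1.2, congrArg Subtype.val q.2⟩⟩, fun q => ⟨⟨q.1, (mem_torsionFiltration_one.1 q.2).1⟩,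
      Subtype.ext (mem_torsionFiltration_one.1 q.2).2⟩, fun _ => rfl, fun _ => rfl⟩
  obtain ⟨u, hu⟩ : ∃ u : LinearMap.ker (LinearMap.lsmul R M a), b ^ k • u ≠ 0 := by
    by_contra! h
    have h2 := natCard_ker_pow_le f k
    rw [hker] at h2
    have h3 : Nat.card (LinearMap.ker (LinearMap.lsmul R M a)) ≤ Nat.card {q // (f ^ k) q = 0} :=
      Nat.card_le_card_of_injective (fun q => ⟨q, (hf k q).trans (h q)⟩) fun q r h =>
        Subtype.mk.inj h
    exact absurd ((Nat.pow_le_pow_iff_right hp.one_lt).1 (hcard.trans (h3.trans h2))) (by omega)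
  -- The last nonzero `b ^ (k + i) u` lies in the first step, which has prime order, and therefore
  -- generates it.
  obtain ⟨i, hi, hi'⟩ : ∃ i : ℕ, b ^ (k + i) • u ≠ 0 ∧ b ^ (k + (i + 1)) • u = 0 := by
    by_contra! h
    have h2 : ∀ i : ℕ, b ^ (k + i) • u ≠ 0 := fun i => by
      induction i with
      | zero => exact hu
      | succ i ih => exact h i ih
    obtain ⟨j, hj⟩ := hb
    exact h2 j (Subtype.ext (by rw [pow_add, mul_smul, Submodule.coe_smul, Submodule.coe_smul, hj,
      smul_zero, Submodule.coe_zero]))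
  have hs : (b ^ (k + i) • u : LinearMap.ker (LinearMap.lsmul R M a)).1 ∈
      torsionFiltration a b M 1 := by
    refine mem_torsionFiltration_one.2 ⟨(b ^ (k + i) • u).2, ?_⟩
    have := congrArg Subtype.val hi'
    rwa [← add_assoc, pow_succ', mul_smul] at this
  have : Fact p.Prime := ⟨hp⟩
  obtain ⟨c, hc⟩ := AddSubgroup.mem_zmultiples_iff.1 (mem_zmultiples_of_prime_card h1
    (g := ⟨_, hs⟩) (g' := ⟨t, ht⟩) fun h => hi (Subtype.ext (Subtype.mk.inj h)))
  have hc' := congrArg Subtype.val hc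
  refine ⟨c • b ^ i • u.1, ?_, ?_⟩
  · have hu0 : a • u.1 = 0 := u.2
    rw [smul_comm, smul_comm a, hu0, smul_zero, smul_zero]
  · rw [smul_comm, smul_smul, ← pow_add]
    exact hc'

theorem natCard_torsionFiltration_two [Finite M] (hp : p.Prime) {m : ℕ}
    (hm : Nat.card M = p ^ m) (ha : ∃ n : ℕ, ∀ q : M, a ^ n • q = 0)
    (hb : ∃ n : ℕ, ∀ q : M, b ^ n • q = 0) (h1 : Nat.card (torsionFiltration a b M 1) = p)
    (hk : 2 ≤ gen R M) : Nat.card (torsionFiltration a b M 2) = p ^ 3 := by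
  have hswap : torsionFiltration b a M 1 = torsionFiltration a b M 1 := by
    ext q; rw [mem_torsionFiltration_one, mem_torsionFiltration_one, and_comm]
  rw [natCard_torsionFiltration_succ_of_surjective h1 fun t => ?_, h1, ← pow_succ']
  -- Coordinate `0` of `monomialMap` is multiplication by `b`, coordinate `1` by `a`; `u` and `v`
  -- each hit one of them.
  obtain ⟨u, hu, hu'⟩ := exists_smul_eq_zero_pow_smul_eq hp hm ha hb h1 hk (t 0).2
  obtain ⟨v, hv, hv'⟩ := exists_smul_eq_zero_pow_smul_eq hp hm hb ha (hswap ▸ h1) hk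
    (t := t 1) (by rw [hswap]; exact (t 1).2)
  rw [pow_one] at hu' hv'
  refine ⟨⟨u + v, mem_torsionFiltration_succ.2 ⟨?_, ?_⟩⟩, ?_⟩
  · rw [smul_add, hu, hv', zero_add]; exact (t 1).2
  · rw [smul_add, hu', hv, add_zero]; exact (t 0).2
  · ext i
    fin_cases i <;> simp [monomialMap, hu, hv, hu', hv']

/-- Elements killed by `a` or by `b` reach only `b²` and `a²`. The mixed coordinate `ab` is reached
by an element killed by `a + b`, since the pair `a + b, b` has the same first step as `a, b`. -/
theorem natCard_torsionFiltration_three [Finite M] (hp : p.Prime) {m : ℕ}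
    (hm : Nat.card M = p ^ m) (ha : ∃ n : ℕ, ∀ q : M, a ^ n • q = 0)
    (hb : ∃ n : ℕ, ∀ q : M, b ^ n • q = 0) (h1 : Nat.card (torsionFiltration a b M 1) = p)
    (hk : 3 ≤ gen R M) : Nat.card (torsionFiltration a b M 3) = p ^ 6 := by
  have hswap : torsionFiltration b a M 1 = torsionFiltration a b M 1 := by
    ext q; rw [mem_torsionFiltration_one, mem_torsionFiltration_one, and_comm]
  have hsum : torsionFiltration (a + b) b M 1 = torsionFiltration a b M 1 := by
    ext q
    rw [mem_torsionFiltration_one, mem_torsionFiltration_one, add_smul]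
    refine and_congr_left fun h => by rw [h, add_zero]
  have hab : ∃ n : ℕ, ∀ q : M, (a + b) ^ n • q = 0 := by
    obtain ⟨i, hi⟩ := ha
    obtain ⟨j, hj⟩ := hb
    refine ⟨i + j, fun q => ?_⟩
    obtain ⟨c, d, h⟩ := Ideal.mem_span_pair.1 (Ideal.add_pow_mem_of_pow_mem_of_le
      (I := Ideal.span {a ^ i, b ^ j}) (a := a) (b := b) (k := i + j)
      (Ideal.subset_span (by simp)) (Ideal.subset_span (by simp)) (Nat.le_succ _))
    rw [← h, add_smul, mul_smul, mul_smul, hi, hj, smul_zero, smul_zero, add_zero]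
  have h2 := natCard_torsionFiltration_two hp hm ha hb h1 (by omega)
  rw [natCard_torsionFiltration_succ_of_surjective h1 fun t => ?_, h2, ← pow_add]
  -- In the coordinates `(b², ab, a²)`, `w` contributes `(-t₁, t₁, -t₁)` because `a w = -b w`. The
  -- summand `t₁` in the targets of `u` and `v` cancels the outer entries.
  obtain ⟨u, hu, hu'⟩ := exists_smul_eq_zero_pow_smul_eq hp hm ha hb h1 hk
    (add_mem (t 0).2 (t 1).2)
  obtain ⟨v, hv, hv'⟩ := exists_smul_eq_zero_pow_smul_eq hp hm hb ha (hswap ▸ h1) hk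
    (t := t 2 + t 1) (by rw [hswap]; exact add_mem (t 2).2 (t 1).2)
  obtain ⟨w, hw, hw'⟩ := exists_smul_eq_zero_pow_smul_eq hp hm hab hb (hsum ▸ h1) hk
    (t := -t 1) (by rw [hsum]; exact neg_mem (t 1).2)
  have hw0 : a • w = -(b • w) := by rwa [add_smul, add_eq_zero_iff_eq_neg] at hw
  have e0 : b • b • (u + v + w) = t 0 := by
    simp only [smul_add]
    rw [hv, smul_zero, add_zero, smul_smul, smul_smul, ← pow_two, hu', hw']
    abel
  have e1 : a • b • (u + v + w) = t 1 := by
    simp only [smul_add]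
    rw [hv, smul_zero, add_zero, smul_comm a b u, hu, smul_zero, zero_add, smul_comm a b, hw0,
      smul_neg, smul_smul, ← pow_two, hw', neg_neg]
  have e2 : a • a • (u + v + w) = t 2 := by
    simp only [smul_add]
    rw [hu, smul_zero, zero_add, smul_smul, ← pow_two, hv', hw0, smul_neg, smul_comm, hw0,
      smul_neg, neg_neg, smul_smul, ← pow_two, hw']
    abel
  refine ⟨⟨u + v + w, mem_torsionFiltration_succ.2 ⟨mem_torsionFiltration_succ.2 ⟨?_, ?_⟩,
    mem_torsionFiltration_succ.2 ⟨?_, ?_⟩⟩⟩, ?_⟩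
  · rw [e2]; exact (t 2).2
  · rw [smul_comm, e1]; exact (t 1).2
  · rw [e1]; exact (t 1).2
  · rw [e0]; exact (t 0).2
  · rw [smul_smul, ← pow_two] at e0 e2
    rw [smul_smul] at e1
    funext i
    apply Subtype.ext
    fin_cases i
    · simpa [monomialMap] using e0
    · simpa [monomialMap] using e1
    · simpa [monomialMap] using e2

theorem pow_seven_le_natCard [Finite M] (hp : p.Prime) {m : ℕ}
    (hm : Nat.card M = p ^ m) (ha : ∃ n : ℕ, ∀ q : M, a ^ n • q = 0)
    (hb : ∃ n : ℕ, ∀ q : M, b ^ n • q = 0) (h1 : Nat.card (torsionFiltration a b M 1) = p)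
    (hk : 4 ≤ gen R M) : p ^ 7 ≤ Nat.card M := by
  have h3 := natCard_torsionFiltration_three hp hm ha hb h1 (by omega)
  have hne : torsionFiltration a b M 3 ≠ ⊤ := by
    intro h
    have : Fact p.Prime := ⟨hp⟩
    have : Nontrivial (torsionFiltration a b M 1) :=
      Finite.one_lt_card_iff_nontrivial.1 (h1 ▸ hp.one_lt)
    obtain ⟨t, ht⟩ := exists_ne (0 : torsionFiltration a b M 1)
    -- Four generators give `b ^ 3 v = t ≠ 0`, so `v` lies outside the third step.
    obtain ⟨v, -, hv⟩ := exists_smul_eq_zero_pow_smul_eq hp hm ha hb h1 hk t.2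
    have hv' := mem_torsionFiltration_add (j := 0).1 (h ▸ Submodule.mem_top (x := v)) 0
      (Nat.zero_le _)
    rw [pow_zero, one_mul, Nat.sub_zero, hv, mem_torsionFiltration_zero] at hv'
    exact ht (Subtype.ext hv')
  have h4 := mul_natCard_le_of_lt hp hm (lt_top_iff_ne_top.2 hne)
  rw [h3, ← pow_succ'] at h4
  exact h4.trans (Nat.card_le_card_of_injective _ Subtype.val_injective)

end Generators

/-! ### Cocyclic modules and their lower bounds -/

section Cocyclic

variable {R : Type*} [CommRing R] {p : ℕ} {b : R}
variable {Q : Type*} [AddCommGroup Q] [Module R Q]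

theorem exists_natCard_eq_prime_pow [Finite Q] (hp : p.Prime)
    (h : ∃ n : ℕ, ∀ q : Q, (p : R) ^ n • q = 0) : ∃ m : ℕ, Nat.card Q = p ^ m := by
  obtain ⟨n, hn⟩ := h
  have : Fact p.Prime := ⟨hp⟩
  refine (IsPGroup.iff_card (p := p) (G := Multiplicative Q)).1 fun q => ⟨n, ?_⟩
  have h1 := hn q.toAdd
  rw [← Nat.cast_pow, Nat.cast_smul_eq_nsmul] at h1
  exact h1

/-- The properties of cocyclic modules with socle `R / (p, b)` that are used for counting. -/
structure IsPrimaryCocyclic (p : ℕ) (b : R) (Q : Type*) [AddCommGroup Q] [Module R Q] : Prop where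
  pow_smul_left : ∃ n : ℕ, ∀ q : Q, (p : R) ^ n • q = 0
  pow_smul_right : ∃ n : ℕ, ∀ q : Q, b ^ n • q = 0
  natCard_torsion : Nat.card (torsionFiltration (p : R) b Q 1) = p

theorem IsCocyclic.isPrimaryCocyclic [IsNoetherianRing R] [Module.Finite R Q]
    (hQ : IsCocyclic R Q) (hp : p.Prime) (hR : HasIntResidues p b)
    {S : Type*} [AddCommGroup S] [Module R S] (e : socle R Q ≃ₗ[R] S)
    (hSp : ∀ s : S, (p : R) • s = 0) (hSb : ∀ s : S, b • s = 0) (hS : Nat.card S = p) :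
    IsPrimaryCocyclic p b Q := by
  have key : ∀ r : R, (∀ s : S, r • s = 0) → ∃ n : ℕ, ∀ q : Q, r ^ n • q = 0 := fun r hr =>
    exists_pow_smul_eq_zero hQ fun q hq => by
      have h1 : r • (⟨q, hq⟩ : socle R Q) = 0 := e.injective (by rw [map_smul, hr, map_zero])
      exact congrArg Subtype.val h1
  refine ⟨key _ hSp, key _ hSb, ?_⟩
  rw [← socle_eq_torsionFiltration_one hp hR (fun q => (key _ hSp).imp fun n hn => hn q)
    fun q => (key _ hSb).imp fun n hn => hn q, Nat.card_congr e.toEquiv, hS]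

/-- An infinite module satisfies every lower bound, so all counting may assume finiteness. -/
theorem pow_le_enatCard_of_finite {Q : Type*} {k : ℕ} (h : Finite Q → p ^ k ≤ Nat.card Q) :
    (p : ℕ∞) ^ k ≤ ENat.card Q := by
  obtain hQ | hQ := finite_or_infinite Q
  · rw [ENat.card_eq_coe_natCard]
    exact_mod_cast h hQ
  · rw [ENat.card_eq_top_of_infinite]
    exact le_top

theorem natCard_eq_of_enatCard_eq {Q : Type*} {n : ℕ} (h : ENat.card Q = n) : Finite Q ∧ Nat.card Q = n :=
  have hfin : Finite Q := ENat.card_lt_top.1 (h ▸ ENat.natCast_lt_top n)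
  ⟨hfin, by rw [ENat.card_eq_coe_natCard] at h; exact_mod_cast h⟩

namespace IsPrimaryCocyclic

theorem prime_pow_three_le (hQ : IsPrimaryCocyclic p b Q) (hp : p.Prime) (hk : 2 ≤ gen R Q) :
    (p : ℕ∞) ^ 3 ≤ ENat.card Q := pow_le_enatCard_of_finite fun _ => by
  obtain ⟨m, hm⟩ := exists_natCard_eq_prime_pow hp hQ.1
  rw [← natCard_torsionFiltration_two hp hm hQ.1 hQ.2 hQ.3 hk]
  exact Nat.card_le_card_of_injective _ Subtype.val_injective

theorem prime_pow_six_le (hQ : IsPrimaryCocyclic p b Q) (hp : p.Prime) (hk : 3 ≤ gen R Q) :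
    (p : ℕ∞) ^ 6 ≤ ENat.card Q := pow_le_enatCard_of_finite fun _ => by
  obtain ⟨m, hm⟩ := exists_natCard_eq_prime_pow hp hQ.1
  rw [← natCard_torsionFiltration_three hp hm hQ.1 hQ.2 hQ.3 hk]
  exact Nat.card_le_card_of_injective _ Subtype.val_injective

theorem prime_pow_seven_le (hQ : IsPrimaryCocyclic p b Q) (hp : p.Prime) (hk : 4 ≤ gen R Q) :
    (p : ℕ∞) ^ 7 ≤ ENat.card Q := pow_le_enatCard_of_finite fun _ => by
  obtain ⟨m, hm⟩ := exists_natCard_eq_prime_pow hp hQ.1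
  exact pow_seven_le_natCard hp hm hQ.1 hQ.2 hQ.3 hk

theorem prime_le (hQ : IsPrimaryCocyclic p b Q) : (p : ℕ∞) ≤ ENat.card Q := by
  rw [← pow_one (p : ℕ∞)]
  refine pow_le_enatCard_of_finite fun _ => ?_
  rw [pow_one]
  nth_rw 1 [← hQ.3]
  exact Nat.card_le_card_of_injective _ Subtype.val_injective

end IsPrimaryCocyclic

theorem eq_top_of_natCard_eq [Finite Q] {N : Submodule R Q} (h : Nat.card N = Nat.card Q) :
    N = ⊤ := by
  have := (AddSubgroup.card_eq_iff_eq_top N.toAddSubgroup).1 h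
  rwa [← Submodule.top_toAddSubgroup (R := R), Submodule.toAddSubgroup_inj] at this

end Cocyclic

/-! ### Prüfer groups and their injectivity -/

section Pruefer

variable {p : ℕ}

/-- `A` is a `p`-divisible `p`-primary group, the `p`-torsion of which is generated by `e ≠ 0`. -/
structure IsPrueferGroup (p : ℕ) (A : Type*) [AddCommGroup A] (e : A) : Prop where
  primary : ∀ y : A, ∃ n : ℕ, (p : ℤ) ^ n • y = 0
  divisible : ∀ y : A, ∃ w : A, (p : ℤ) • w = y
  smul_gen : (p : ℤ) • e = 0
  gen_ne_zero : e ≠ 0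
  exists_eq_smul_gen : ∀ y : A, (p : ℤ) • y = 0 → ∃ n : ℤ, y = n • e

theorem exists_isPrueferGroup_of_surjective (hp : p.Prime) {A : Type*} [AddCommGroup A]
    (f : Localization.Away (p : ℤ) →+ A) (hsurj : Function.Surjective f)
    (hker : ∀ z, f z = 0 ↔ ∃ n : ℤ, (n : Localization.Away (p : ℤ)) = z) :
    ∃ e : A, IsPrueferGroup p A e := by
  let i : Localization.Away (p : ℤ) := IsLocalization.Away.invSelf (p : ℤ)
  have hi : ((p : ℤ) : Localization.Away (p : ℤ)) * i = 1 := by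
    have := IsLocalization.Away.mul_invSelf (S := Localization.Away (p : ℤ)) (p : ℤ)
    rwa [eq_intCast] at this
  refine ⟨f i, fun y => ?_, fun y => ?_, ?_, fun h => ?_, fun y hy => ?_⟩
  · obtain ⟨z, rfl⟩ := hsurj y
    obtain ⟨n, c, h⟩ := IsLocalization.Away.surj (p : ℤ) z
    rw [eq_intCast, eq_intCast, mul_comm, ← Int.cast_pow, ← zsmul_eq_mul] at h
    exact ⟨n, by rw [← map_zsmul, hker]; exact ⟨c, h.symm⟩⟩
  · obtain ⟨z, rfl⟩ := hsurj y
    exact ⟨f (i * z), by rw [← map_zsmul, zsmul_eq_mul, ← mul_assoc, hi, one_mul]⟩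
  · rw [← map_zsmul, zsmul_eq_mul, hi, hker]
    exact ⟨1, Int.cast_one⟩
  · obtain ⟨n, hn⟩ := (hker i).1 h
    rw [← hn, ← Int.cast_mul] at hi
    have hinj : Function.Injective (algebraMap ℤ (Localization.Away (p : ℤ))) :=
      IsLocalization.injective _ (powers_le_nonZeroDivisors_of_noZeroDivisors
        (Int.natCast_ne_zero.2 hp.ne_zero))
    have h2 : (p : ℤ) * n = 1 := hinj (by rw [eq_intCast, eq_intCast, hi, Int.cast_one])
    exact (Nat.prime_iff_prime_int.1 hp).not_isUnit (IsUnit.of_mul_eq_one _ h2)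
  · obtain ⟨z, rfl⟩ := hsurj y
    rw [← map_zsmul, hker] at hy
    obtain ⟨n, hn⟩ := hy
    exact ⟨n, by rw [← map_zsmul, zsmul_eq_mul, hn, zsmul_eq_mul, mul_right_comm, hi, one_mul]⟩

theorem exists_isPrueferGroup (hp : p.Prime) : ∃ e : Pruefer p, IsPrueferGroup p (Pruefer p) e :=
  exists_isPrueferGroup_of_surjective hp (QuotientAddGroup.mk' _)
    (QuotientAddGroup.mk'_surjective _) fun z => QuotientAddGroup.eq_zero_iff z

namespace IsPrueferGroup

variable {A : Type*} [AddCommGroup A] {e : A}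

/-- Write `n` as a power of `p` times some `c` prime to `p`: the power is handled by divisibility,
and `c` is invertible modulo a power of `p` killing `y`. -/
theorem smul_surjective (hA : IsPrueferGroup p A e) (hp : p.Prime) {n : ℤ} (hn : n ≠ 0) :
    Function.Surjective fun y : A => n • y := by
  intro y
  have hpow : ∀ (k : ℕ) (y : A), ∃ w : A, (p : ℤ) ^ k • w = y := by
    intro k
    induction k with
    | zero => exact fun y => ⟨y, by simp⟩
    | succ k ih =>
      intro y
      obtain ⟨w, hw⟩ := hA.divisible y
      obtain ⟨v, hv⟩ := ih w
      exact ⟨v, by rw [pow_succ', mul_smul, hv, hw]⟩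
  have hfin : FiniteMultiplicity (p : ℤ) n :=
    Int.finiteMultiplicity_iff.2 ⟨by simpa using hp.ne_one, hn⟩
  obtain ⟨c, hc, hpc⟩ := hfin.exists_eq_pow_mul_and_not_dvd
  obtain ⟨m, hm⟩ := hA.primary y
  obtain ⟨u, v, huv⟩ : IsCoprime c ((p : ℤ) ^ m) :=
    (((Nat.prime_iff_prime_int.1 hp).irreducible.coprime_iff_not_dvd).2 hpc).symm.pow_right
  obtain ⟨w, hw⟩ := hpow (multiplicity (p : ℤ) n) (u • y)
  refine ⟨w, ?_⟩
  change n • w = y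
  rw [hc, mul_comm, mul_smul, hw]
  nth_rw 2 [← one_zsmul y]
  rw [← huv, add_smul, mul_smul v, hm, smul_zero, add_zero, smul_smul, mul_comm]

theorem baer (hA : IsPrueferGroup p A e) (hp : p.Prime) : Module.Baer ℤ A :=
  letI : DivisibleBy A ℤ := divisibleByOfSMulRightSurj _ _ fun hn => hA.smul_surjective hp hn
  Module.Baer.of_divisible _

theorem natCard_torsion_le (hA : IsPrueferGroup p A e) (hp : p.Prime) :
    Finite {y : A // (p : ℤ) • y = 0} ∧ Nat.card {y : A // (p : ℤ) • y = 0} ≤ p := by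
  have hsurj : Function.Surjective fun i : Fin p => (⟨(i : ℤ) • e, by
      rw [smul_comm, hA.smul_gen, smul_zero]⟩ : {y : A // (p : ℤ) • y = 0}) := by
    rintro ⟨y, hy⟩
    obtain ⟨n, rfl⟩ := hA.exists_eq_smul_gen y hy
    have hp0 : (p : ℤ) ≠ 0 := by exact_mod_cast hp.ne_zero
    have h0 := Int.emod_nonneg n hp0
    have h1 := Int.emod_lt_of_pos n (show (0 : ℤ) < p by exact_mod_cast hp.pos)
    refine ⟨⟨(n % p).toNat, by omega⟩, Subtype.ext ?_⟩
    change (((n % p).toNat : ℕ) : ℤ) • e = n • e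
    rw [Int.toNat_of_nonneg h0]
    conv_rhs => rw [← Int.emod_add_mul_ediv n p, add_smul, mul_comm, mul_smul, hA.smul_gen,
      smul_zero, add_zero]
  exact ⟨Finite.of_surjective _ hsurj, (Nat.card_le_card_of_surjective _ hsurj).trans_eq (by simp)⟩

/-- Homomorphisms into a Prüfer group detect elements of order `p`. -/
theorem exists_hom_ne_zero (hA : IsPrueferGroup p A e) (hp : p.Prime) {B : Type*} [AddCommGroup B]
    {s : B} (hs : (p : ℤ) • s = 0) (hs0 : s ≠ 0) : ∃ f : B →+ A, f s ≠ 0 := by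
  have horder : addOrderOf s = p := by
    have : Fact p.Prime := ⟨hp⟩
    exact addOrderOf_eq_prime (by rw [← natCast_zsmul]; exact hs) hs0
  let i : ZMod p →+ B := ZMod.lift p ⟨zmultiplesHom B s, hs⟩
  let g : ZMod p →+ A := ZMod.lift p ⟨zmultiplesHom A e, hA.smul_gen⟩
  have hi : Function.Injective i := by
    refine (ZMod.lift_injective _).2 fun m hm => ?_
    rw [ZMod.intCast_zmod_eq_zero_iff_dvd, ← horder]
    exact addOrderOf_dvd_iff_zsmul_eq_zero.2 (by simpa using hm)
  obtain ⟨f, hf⟩ := (hA.baer hp).extension_property_addMonoidHom i hi g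
  have h1 : i 1 = s := by
    have := ZMod.lift_coe p ⟨zmultiplesHom B s, hs⟩ 1
    simpa using this
  have h2 : g 1 = e := by
    have := ZMod.lift_coe p ⟨zmultiplesHom A e, hA.smul_gen⟩ 1
    simpa using this
  refine ⟨f, ?_⟩
  rw [← h1]
  change f.comp i 1 ≠ 0
  -- `f` extends the map sending `s` to `e` from the subgroup generated by `s`, which exists because
  -- a divisible group is injective.
  rw [hf, h2]
  exact hA.gen_ne_zero

end IsPrueferGroup

end Pruefer

/-! ### The module of divided powers -/

section DividedPowers

variable {p : ℕ} {A : Type*} [AddCommGroup A] {e : A}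

theorem dividedPowers_X_pow_smul_apply (i : ℕ) (q : DividedPowers ℤ A) (n : ℕ) :
    (Module.AEval'.of (seqShift ℤ A)).symm ((X : ℤ[X]) ^ i • q) n =
      (Module.AEval'.of (seqShift ℤ A)).symm q (n + i) := by
  obtain ⟨a, rfl⟩ := (Module.AEval'.of (seqShift ℤ A)).surjective q
  rw [Module.AEval'.X_pow_smul_of, LinearEquiv.symm_apply_apply, LinearEquiv.symm_apply_apply,
    ← seqShift_pow_apply ℤ]
  rfl

theorem dividedPowers_ext {q r : DividedPowers ℤ A}
    (h : ∀ n, (Module.AEval'.of (seqShift ℤ A)).symm q n =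
      (Module.AEval'.of (seqShift ℤ A)).symm r n) : q = r :=
  (Module.AEval'.of (seqShift ℤ A)).symm.injective (Finsupp.ext h)

theorem dividedPowers_natCast_pow_smul_apply (i : ℕ) (q : DividedPowers ℤ A) (n : ℕ) :
    (Module.AEval'.of (seqShift ℤ A)).symm ((p : ℤ[X]) ^ i • q) n =
      (p : ℤ) ^ i • (Module.AEval'.of (seqShift ℤ A)).symm q n := by
  rw [← Nat.cast_pow, Nat.cast_smul_eq_nsmul, map_nsmul, Finsupp.smul_apply, ← natCast_zsmul,
    Nat.cast_pow]

theorem dividedPowers_exists_X_pow_smul_eq_zero (q : DividedPowers ℤ A) :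
    ∃ n : ℕ, (X : ℤ[X]) ^ n • q = 0 := by
  refine ⟨((Module.AEval'.of (seqShift ℤ A)).symm q).support.sup id + 1,
    dividedPowers_ext fun n => ?_⟩
  rw [dividedPowers_X_pow_smul_apply, map_zero, Finsupp.zero_apply]
  by_contra h
  have := Finset.le_sup (f := id) (Finsupp.mem_support_iff.2 h)
  simp only [id] at this
  omega

theorem dividedPowers_exists_natCast_pow_smul_eq_zero (hA : IsPrueferGroup p A e)
    (q : DividedPowers ℤ A) : ∃ n : ℕ, (p : ℤ[X]) ^ n • q = 0 := by
  choose k hk using hA.primary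
  set a := (Module.AEval'.of (seqShift ℤ A)).symm q with ha
  refine ⟨∑ i ∈ a.support, k (a i), dividedPowers_ext fun n => ?_⟩
  rw [dividedPowers_natCast_pow_smul_apply, map_zero, Finsupp.zero_apply, ← ha]
  by_cases h : n ∈ a.support
  · obtain ⟨c, hc⟩ := pow_dvd_pow (p : ℤ)
      (Finset.single_le_sum (f := fun i => k (a i)) (fun _ _ => Nat.zero_le _) h)
    rw [hc, mul_comm, mul_smul, hk, smul_zero]
  · rw [Finsupp.notMem_support_iff.1 h, smul_zero]

/-- A sequence killed by `x` vanishes outside index `0`, and its value there is killed by `p`. -/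
theorem dividedPowers_torsionFiltration_one (hA : IsPrueferGroup p A e) (hp : p.Prime) :
    Finite (torsionFiltration (p : ℤ[X]) X (DividedPowers ℤ A) 1) ∧
      Nat.card (torsionFiltration (p : ℤ[X]) X (DividedPowers ℤ A) 1) ≤ p := by
  obtain ⟨h1, h2⟩ := hA.natCard_torsion_le hp
  let f : torsionFiltration (p : ℤ[X]) X (DividedPowers ℤ A) 1 → {y : A // (p : ℤ) • y = 0} :=
    fun q => ⟨(Module.AEval'.of (seqShift ℤ A)).symm q.1 0, by
      have h := dividedPowers_natCast_pow_smul_apply (p := p) 1 q.1 0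
      rw [pow_one, pow_one, (mem_torsionFiltration_one.1 q.2).1, LinearEquiv.map_zero,
        Finsupp.zero_apply] at h
      exact h.symm⟩
  have hf : Function.Injective f := fun q r h => by
    have key : ∀ (q : torsionFiltration (p : ℤ[X]) X (DividedPowers ℤ A) 1) (n : ℕ),
        (Module.AEval'.of (seqShift ℤ A)).symm q.1 (n + 1) = 0 := fun q n => by
      rw [← dividedPowers_X_pow_smul_apply, pow_one, (mem_torsionFiltration_one.1 q.2).2, map_zero,
        Finsupp.zero_apply]
    refine Subtype.ext (dividedPowers_ext fun n => ?_)
    cases n with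
    | zero => exact Subtype.mk.inj h
    | succ n => rw [key, key]
  exact ⟨Finite.of_injective f hf, (Nat.card_le_card_of_injective f hf).trans h2⟩

theorem hasIntResidues_X_sub_C (p : ℕ) (c : ℤ) : HasIntResidues p (X - C c : ℤ[X]) := fun r => by
  -- `r` is congruent to its value at `c` modulo `X - C c`.
  refine ⟨r.eval c, ?_⟩
  rw [← eq_intCast (C : ℤ →+* ℤ[X])]
  obtain ⟨g, hg⟩ := X_sub_C_dvd_sub_C_eval (a := c) (p := r)
  exact Ideal.mem_span_pair.2 ⟨0, g, by rw [hg, zero_mul, zero_add, mul_comm]⟩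

theorem hasIntResidues_X (p : ℕ) : HasIntResidues p (X : ℤ[X]) := by
  simpa using hasIntResidues_X_sub_C p 0

theorem hasIntResidues_X_add_one (p : ℕ) : HasIntResidues p (X + 1 : ℤ[X]) := by
  simpa using hasIntResidues_X_sub_C p (-1)

theorem socleSeries_dividedPowers (hA : IsPrueferGroup p A e) (hp : p.Prime) (k : ℕ) :
    socleSeries ℤ[X] (DividedPowers ℤ A) k =
      torsionFiltration (p : ℤ[X]) X (DividedPowers ℤ A) k :=
  socleSeries_eq_torsionFiltration hp (hasIntResidues_X p)
    (dividedPowers_exists_natCast_pow_smul_eq_zero hA) dividedPowers_exists_X_pow_smul_eq_zero k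

variable {M : Type*} [AddCommGroup M] [Module ℤ[X] M]

/-- The `ℤ[x]`-linear map `q ↦ (f(q), f(xq), f(x²q), …)`. -/
noncomputable def toDividedPowers (f : M →+ A) {n : ℕ} (hn : ∀ q : M, (X : ℤ[X]) ^ n • q = 0) :
    M →ₗ[ℤ[X]] DividedPowers ℤ A :=
  let g : M →+ DividedPowers ℤ A :=
    { toFun := fun q => Module.AEval'.of (seqShift ℤ A) <|
        Finsupp.onFinset (Finset.range n) (fun i => f ((X : ℤ[X]) ^ i • q)) fun i hi => by
          rw [Finset.mem_range]
          by_contra! h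
          obtain ⟨j, rfl⟩ := Nat.exists_eq_add_of_le h
          exact hi (by rw [pow_add, mul_comm, mul_smul, hn, smul_zero, map_zero])
      map_zero' := dividedPowers_ext fun i => by simp
      map_add' := fun q r => dividedPowers_ext fun i => by simp }
  { g with
    map_smul' := fun r q => by
      change g (r • q) = r • g q
      have hC : ∀ (c : ℤ) (q : M), g (C c • q) = C c • g q := fun c q => by
        rw [eq_intCast, Int.cast_smul_eq_zsmul, Int.cast_smul_eq_zsmul, map_zsmul]
      have hX : ∀ (k : ℕ) (q : M), g ((X : ℤ[X]) ^ k • q) = (X : ℤ[X]) ^ k • g q := fun k q =>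
        dividedPowers_ext fun i => by
          rw [dividedPowers_X_pow_smul_apply]
          simp [g, smul_smul, pow_add]
      induction r using Polynomial.induction_on' with
      | add r s hr hs => rw [add_smul, map_add, hr, hs, add_smul]
      | monomial k c => rw [← C_mul_X_pow_eq_monomial, mul_smul, hC, hX, mul_smul] }

theorem toDividedPowers_apply_zero (f : M →+ A) {n : ℕ} (hn : ∀ q : M, (X : ℤ[X]) ^ n • q = 0)
    (q : M) : (Module.AEval'.of (seqShift ℤ A)).symm (toDividedPowers f hn q) 0 = f q := by
  change f ((X : ℤ[X]) ^ 0 • q) = f q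
  rw [pow_zero, one_smul]

end DividedPowers

/-! ### Embedding into the divided powers of the Prüfer group -/

section Embedding

theorem exists_pow_smul_ne_zero {R M : Type*} [CommRing R] [AddCommGroup M] [Module R M] {a : R}
    (ha : ∃ n : ℕ, ∀ q : M, a ^ n • q = 0) {q : M} (hq : q ≠ 0) :
    ∃ n : ℕ, a ^ n • q ≠ 0 ∧ a • a ^ n • q = 0 := by
  classical
  have hex : ∃ n : ℕ, a ^ n • q = 0 := ha.imp fun n hn => hn q
  obtain ⟨n, hn⟩ : ∃ n, Nat.find hex = n + 1 := by
    refine Nat.exists_eq_succ_of_ne_zero fun h0 => hq ?_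
    have := Nat.find_spec hex
    rwa [h0, pow_zero, one_smul] at this
  refine ⟨n, Nat.find_min hex (by omega), ?_⟩
  rw [smul_smul, ← pow_succ', ← hn]
  exact Nat.find_spec hex

variable {p : ℕ} {A : Type*} [AddCommGroup A] {e : A}
variable {M : Type*} [AddCommGroup M] [Module ℤ[X] M]

theorem map_mem_torsionFiltration {R M N : Type*} [CommRing R] [AddCommGroup M] [Module R M]
    [AddCommGroup N] [Module R N] {a b : R} (f : M →ₗ[R] N) {k : ℕ} {q : M}
    (hq : q ∈ torsionFiltration a b M k) : f q ∈ torsionFiltration a b N k := by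
  induction k generalizing q with
  | zero => rw [mem_torsionFiltration_zero.1 hq, map_zero]; exact Submodule.zero_mem _
  | succ k ih =>
    rw [mem_torsionFiltration_succ] at hq ⊢
    rw [← map_smul, ← map_smul]
    exact ⟨ih hq.1, ih hq.2⟩

/-- Choose `f` nonzero on the torsion step of order `p`, hence injective there. A nonzero `q` in the
kernel of `toDividedPowers f` would have a nonzero multiple `s` in that step, with `f s = 0`. -/
theorem IsPrimaryCocyclic.exists_injective (hM : IsPrimaryCocyclic p (X : ℤ[X]) M)
    (hA : IsPrueferGroup p A e) (hp : p.Prime) :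
    ∃ f : M →ₗ[ℤ[X]] DividedPowers ℤ A, Function.Injective f := by
  have : Fact p.Prime := ⟨hp⟩
  have : Finite (torsionFiltration (p : ℤ[X]) X M 1) :=
    Nat.finite_of_card_ne_zero (hM.3.trans_ne hp.ne_zero)
  have : Nontrivial (torsionFiltration (p : ℤ[X]) X M 1) :=
    Finite.one_lt_card_iff_nontrivial.1 (hp.one_lt.trans_eq hM.3.symm)
  obtain ⟨t, ht⟩ := exists_ne (0 : torsionFiltration (p : ℤ[X]) X M 1)
  obtain ⟨f, hf⟩ := hA.exists_hom_ne_zero hp (s := t.1)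
    (natCast_smul_eq_zero_iff.1 (mem_torsionFiltration_one.1 t.2).1) fun h => ht (Subtype.ext h)
  obtain ⟨n, hn⟩ := hM.2
  refine ⟨toDividedPowers f hn, (injective_iff_map_eq_zero _).2 fun q hq => ?_⟩
  by_contra hq0
  obtain ⟨i, hi, hi'⟩ := exists_pow_smul_ne_zero hM.1 hq0
  obtain ⟨j, hj, hj'⟩ := exists_pow_smul_ne_zero hM.2 hi
  let s : torsionFiltration (p : ℤ[X]) X M 1 := ⟨(X : ℤ[X]) ^ j • (p : ℤ[X]) ^ i • q,
    mem_torsionFiltration_one.2 ⟨by rw [smul_comm, hi', smul_zero], hj'⟩⟩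
  have hs : f s.1 = 0 := by
    rw [← toDividedPowers_apply_zero f hn, (toDividedPowers f hn).map_smul,
      (toDividedPowers f hn).map_smul, hq, smul_zero, smul_zero, LinearEquiv.map_zero,
      Finsupp.zero_apply]
  obtain ⟨c, hc⟩ := AddSubgroup.mem_zmultiples_iff.1
    (mem_zmultiples_of_prime_card hM.3 (g := s) (g' := t) fun h => hj (Subtype.mk.inj h))
  apply hf
  rw [← hc, Submodule.coe_smul_of_tower, map_zsmul, hs, smul_zero]

/-- The embedding preserves the filtration, so only an upper bound for the order of the target is
needed to make it bijective. -/
theorem IsPrimaryCocyclic.nonempty_equiv_dividedPowers (hM : IsPrimaryCocyclic p (X : ℤ[X]) M)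
    (hA : IsPrueferGroup p A e) (hp : p.Prime) {k : ℕ} (htop : torsionFiltration (p : ℤ[X]) X M k = ⊤)
    (hcard : Nat.card M = p ^ (k * (k + 1) / 2)) :
    Nonempty (M ≃ₗ[ℤ[X]] socleSeries ℤ[X] (DividedPowers ℤ A) k) := by
  rw [socleSeries_dividedPowers hA hp]
  obtain ⟨h1, h2⟩ := dividedPowers_torsionFiltration_one hA hp
  have hfin := finite_torsionFiltration (a := (p : ℤ[X])) (b := X) (M := DividedPowers ℤ A) k
  obtain ⟨f, hf⟩ := hM.exists_injective hA hp
  let g : M →ₗ[ℤ[X]] torsionFiltration (p : ℤ[X]) X (DividedPowers ℤ A) k :=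
    f.codRestrict _ fun q => map_mem_torsionFiltration f (htop ▸ Submodule.mem_top)
  have hg : Function.Injective g := fun q r h => hf (Subtype.mk.inj h)
  exact ⟨LinearEquiv.ofBijective g (hg.bijective_of_nat_card_le
    (hcard ▸ natCard_torsionFiltration_le h2 k))⟩

theorem IsPrimaryCocyclic.nonempty_equiv (hM : IsPrimaryCocyclic p (X : ℤ[X]) M)
    (hp : p.Prime) {k : ℕ} (htop : torsionFiltration (p : ℤ[X]) X M k = ⊤)
    (hcard : Nat.card M = p ^ (k * (k + 1) / 2)) :
    Nonempty (M ≃ₗ[ℤ[X]] socleSeries ℤ[X] (PrueferDividedPowers p) k) := by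
  obtain ⟨e, hA⟩ := exists_isPrueferGroup hp
  exact hM.nonempty_equiv_dividedPowers hA hp htop hcard

end Embedding

/-! ### The modules `P₁`, `P₂` and `P₁,₁` -/

section PModules

variable {p : ℕ}

theorem natCard_PGroup (p m : ℕ) : Nat.card (PGroup p m) = ∏ i : Fin m, p ^ (m - (i : ℕ)) := by
  rw [Nat.card_pi]
  simp

theorem pShift_one (p : ℕ) : pShift p 1 = 0 :=
  LinearMap.ext fun a => funext fun n => by rw [pShift_apply, dif_neg (by omega)]; rfl

theorem natCast_smul_PGroup_one (a : PGroup p 1) : p • a = 0 := by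
  funext i
  have hi : (i : ℕ) = 0 := by omega
  rw [Pi.smul_apply, nsmul_eq_mul, (ZMod.natCast_eq_zero_iff _ _).2 (by rw [hi]; simp), zero_mul]
  rfl

theorem natCast_smul_P_one (q : P p 1) : (p : ℤ[X]) • q = 0 := by
  rw [Nat.cast_smul_eq_nsmul]
  exact natCast_smul_PGroup_one (p := p) q

theorem natCast_smul_P₁_one (q : P₁ p 1) : (p : ℤ[X]) • q = 0 := by
  rw [Nat.cast_smul_eq_nsmul]
  exact natCast_smul_PGroup_one (p := p) q

theorem X_smul_P_one (q : P p 1) : (X : ℤ[X]) • q = 0 := by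
  obtain ⟨a, rfl⟩ := (Module.AEval'.of (pShift p 1)).surjective q
  rw [Module.AEval'.X_smul_of, pShift_one]
  rfl

theorem X_add_one_smul_P₁_one (q : P₁ p 1) : (X + 1 : ℤ[X]) • q = 0 := by
  obtain ⟨a, rfl⟩ := (Module.AEval'.of (pShift p 1 - 1)).surjective q
  have h : (pShift p 1 - 1) a + a = 0 := by rw [pShift_one]; simp
  rw [add_smul, one_smul, Module.AEval'.X_smul_of, ← map_add]
  exact (congrArg _ h).trans (map_zero _)

theorem natCard_P_one (p : ℕ) : Nat.card (P p 1) = p :=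
  (natCard_PGroup p 1).trans (by simp)

theorem natCard_P₁_one (p : ℕ) : Nat.card (P₁ p 1) = p :=
  (natCard_PGroup p 1).trans (by simp)

theorem torsionFiltration_P_one (p : ℕ) : torsionFiltration (p : ℤ[X]) X (P p 1) 1 = ⊤ :=
  eq_top_iff.2 fun q _ => mem_torsionFiltration_one.2 ⟨natCast_smul_P_one q, X_smul_P_one q⟩

theorem isPrimaryCocyclic_P_one (p : ℕ) : IsPrimaryCocyclic p (X : ℤ[X]) (P p 1) where
  pow_smul_left := ⟨1, fun q => by rw [pow_one, natCast_smul_P_one]⟩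
  pow_smul_right := ⟨1, fun q => by rw [pow_one, X_smul_P_one]⟩
  natCard_torsion := by
    rw [torsionFiltration_P_one, Nat.card_congr Submodule.topEquiv.toEquiv, natCard_P_one]

/-- With `exists_mulP_one_two_eq` and `nsmul_mulP_one_two`, this identifies `ℤ/p` with the
`p`-torsion of `ℤ/p²`, which becomes the torsion step of `P₂`. -/
theorem mulP_one_two_injective (hp : p.Prime) : Function.Injective (mulP p 1 2 le_rfl) := by
  refine (injective_iff_map_eq_zero _).2 fun c hc => ?_
  obtain ⟨u, rfl⟩ := ZMod.intCast_surjective c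
  rw [mulP_intCast, ZMod.intCast_zmod_eq_zero_iff_dvd, Nat.cast_pow, pow_two] at hc
  rw [ZMod.intCast_zmod_eq_zero_iff_dvd, pow_one]
  exact Int.dvd_of_mul_dvd_mul_left (Int.natCast_ne_zero.2 hp.ne_zero) hc

theorem exists_mulP_one_two_eq (hp : p.Prime) {y : ZMod (p ^ 2)} (hy : p • y = 0) :
    ∃ c, mulP p 1 2 le_rfl c = y := by
  obtain ⟨u, rfl⟩ := ZMod.intCast_surjective y
  rw [nsmul_eq_mul, ← Int.cast_natCast, ← Int.cast_mul, ZMod.intCast_zmod_eq_zero_iff_dvd,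
    Nat.cast_pow, pow_two] at hy
  obtain ⟨v, rfl⟩ := Int.dvd_of_mul_dvd_mul_left (Int.natCast_ne_zero.2 hp.ne_zero) hy
  exact ⟨v, mulP_intCast p 1 2 le_rfl v⟩

theorem nsmul_mulP_one_two (c : ZMod (p ^ 1)) : p • mulP p 1 2 le_rfl c = 0 := by
  have hc : p • c = 0 := by
    rw [nsmul_eq_mul, (ZMod.natCast_eq_zero_iff _ _).2 (by rw [pow_one]), zero_mul]
  rw [← map_nsmul, hc, map_zero]

theorem pShift_two_apply_zero (a : PGroup p 2) : pShift p 2 a 0 = mulP p 1 2 le_rfl (a 1) := by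
  rw [pShift_apply, dif_pos (by simp)]
  rfl

theorem pShift_two_apply_one (a : PGroup p 2) : pShift p 2 a 1 = 0 := by
  rw [pShift_apply, dif_neg (by simp)]

theorem nsmul_pShift_two (a : PGroup p 2) : p • pShift p 2 a = 0 := by
  funext i
  rw [Pi.smul_apply]
  fin_cases i
  · exact (congrArg (p • ·) (pShift_two_apply_zero a)).trans (nsmul_mulP_one_two _)
  · exact (congrArg (p • ·) (pShift_two_apply_one a)).trans (smul_zero p)

theorem nsmul_nsmul_PGroup_two (a : PGroup p 2) : p • p • a = 0 := by
  funext i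
  rw [Pi.smul_apply, Pi.smul_apply, smul_smul, nsmul_eq_mul, (ZMod.natCast_eq_zero_iff _ _).2,
    zero_mul]
  · rfl
  · rw [← pow_two]
    exact pow_dvd_pow p (Nat.sub_le _ _)

theorem pShift_pShift_two (a : PGroup p 2) : pShift p 2 (pShift p 2 a) = 0 := by
  funext i
  fin_cases i
  · refine (pShift_two_apply_zero _).trans ?_
    rw [pShift_two_apply_one, map_zero]
    rfl
  · exact pShift_two_apply_one _

theorem natCast_smul_of_P (a : PGroup p 2) :
    (p : ℤ[X]) • Module.AEval'.of (pShift p 2) a = Module.AEval'.of (pShift p 2) (p • a) := by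
  rw [Nat.cast_smul_eq_nsmul, map_nsmul]

theorem torsionFiltration_P_two (p : ℕ) : torsionFiltration (p : ℤ[X]) X (P p 2) 2 = ⊤ := by
  refine eq_top_iff.2 fun q _ => ?_
  obtain ⟨a, rfl⟩ := (Module.AEval'.of (pShift p 2)).surjective q
  have h1 : (X : ℤ[X]) • (p : ℤ[X]) • Module.AEval'.of (pShift p 2) a = 0 := by
    rw [smul_comm, Module.AEval'.X_smul_of, natCast_smul_of_P]
    exact (congrArg _ (nsmul_pShift_two a)).trans (map_zero _)
  refine mem_torsionFiltration_succ.2 ⟨mem_torsionFiltration_one.2 ⟨?_, h1⟩,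
    mem_torsionFiltration_one.2 ⟨(smul_comm _ _ _).trans h1, ?_⟩⟩
  · rw [natCast_smul_of_P, natCast_smul_of_P, nsmul_nsmul_PGroup_two, map_zero]
  · rw [Module.AEval'.X_smul_of, Module.AEval'.X_smul_of]
    exact (congrArg _ (pShift_pShift_two a)).trans (map_zero _)

theorem natCard_torsionFiltration_P_two (hp : p.Prime) :
    Nat.card (torsionFiltration (p : ℤ[X]) X (P p 2) 1) = p := by
  have hmem : ∀ a : PGroup p 2, Module.AEval'.of (pShift p 2) a ∈
      torsionFiltration (p : ℤ[X]) X (P p 2) 1 ↔ p • a = 0 ∧ pShift p 2 a = 0 := fun a => by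
    rw [mem_torsionFiltration_one, natCast_smul_of_P, Module.AEval'.X_smul_of,
      LinearEquiv.map_eq_zero_iff, LinearEquiv.map_eq_zero_iff]
  let v : ZMod (p ^ 1) → PGroup p 2 := fun c =>
    Fin.cons (mulP p 1 2 le_rfl c) (fun _ => 0)
  have hv0 : ∀ c, v c 0 = mulP p 1 2 le_rfl c := fun _ => rfl
  have hv1 : ∀ c, v c 1 = 0 := fun _ => rfl
  have hv : ∀ c, Module.AEval'.of (pShift p 2) (v c) ∈
      torsionFiltration (p : ℤ[X]) X (P p 2) 1 := fun c => by
    refine (hmem _).2 ⟨?_, ?_⟩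
    · funext i
      rw [Pi.smul_apply]
      fin_cases i
      · exact nsmul_mulP_one_two c
      · exact smul_zero p
    · funext i
      fin_cases i
      · refine (pShift_two_apply_zero _).trans ?_
        rw [hv1, map_zero]
        rfl
      · exact pShift_two_apply_one _
  have hbij : Function.Bijective fun c => (⟨_, hv c⟩ :
      torsionFiltration (p : ℤ[X]) X (P p 2) 1) := by
    refine ⟨fun c d h => ?_, fun q => ?_⟩
    · have h' := congrFun ((Module.AEval'.of (pShift p 2)).injective (Subtype.mk.inj h)) 0
      exact mulP_one_two_injective hp h'
    · obtain ⟨q, hq⟩ := q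
      obtain ⟨a, rfl⟩ := (Module.AEval'.of (pShift p 2)).surjective q
      obtain ⟨h1, h2⟩ := (hmem a).1 hq
      obtain ⟨c, hc⟩ := exists_mulP_one_two_eq hp (congrFun h1 0)
      -- Being killed by `x` means `p a(1) = 0` in `ℤ/p²`, which forces `a(1) = 0` in `ℤ/p`.
      have h3 : a 1 = 0 := mulP_one_two_injective hp
        ((pShift_two_apply_zero a).symm.trans ((congrFun h2 0).trans (map_zero _).symm))
      refine ⟨c, Subtype.ext (congrArg (Module.AEval'.of (pShift p 2))
        (_root_.funext fun i => ?_ : v c = a))⟩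
      fin_cases i
      · exact hc
      · exact h3.symm
  rw [← Nat.card_eq_of_bijective _ hbij, Nat.card_zmod, pow_one]

theorem isPrimaryCocyclic_P_two (hp : p.Prime) : IsPrimaryCocyclic p (X : ℤ[X]) (P p 2) where
  pow_smul_left := ⟨2, fun q => by
    have hq : q ∈ torsionFiltration (p : ℤ[X]) X (P p 2) 2 := by simp [torsionFiltration_P_two]
    rw [pow_two, mul_smul]
    exact (mem_torsionFiltration_one.1 hq.1).1⟩
  pow_smul_right := ⟨2, fun q => by
    have hq : q ∈ torsionFiltration (p : ℤ[X]) X (P p 2) 2 := by simp [torsionFiltration_P_two]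
    rw [pow_two, mul_smul]
    exact (mem_torsionFiltration_one.1 hq.2).2⟩
  natCard_torsion := natCard_torsionFiltration_P_two hp

theorem natCard_P_two (p : ℕ) : Nat.card (P p 2) = p ^ 3 :=
  (natCard_PGroup p 2).trans (by simp [Fin.prod_univ_two, ← pow_succ])

end PModules

/-! ### The localized ring `R₂` -/

section R₂

variable {p : ℕ}

/-- Modulo `(p, x + 1)` the generators `x` and `1 - x` become `-1` and `2`, both invertible modulo
an odd `p`. -/
theorem exists_mul_sub_one_mem (hp : p.Prime) (h2 : p ≠ 2) {s : ℤ[X]} (hs : s ∈ R₂Denom) :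
    ∃ u : ℤ, (u : ℤ[X]) * s - 1 ∈ Ideal.span {(p : ℤ[X]), X + 1} := by
  induction hs using Submonoid.closure_induction with
  | mem s hs =>
    obtain rfl | rfl := hs
    · exact ⟨-1, Ideal.mem_span_pair.2 ⟨0, -1, by push_cast; ring⟩⟩
    · obtain ⟨u, v, huv⟩ : IsCoprime (2 : ℤ) p := by
        exact_mod_cast Nat.isCoprime_iff_coprime.2 ((Nat.coprime_primes Nat.prime_two hp).2 h2.symm)
      have huv' : (u : ℤ[X]) * 2 + v * p = 1 := by exact_mod_cast congrArg (Int.cast : ℤ → ℤ[X]) huv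
      exact ⟨u, Ideal.mem_span_pair.2 ⟨-v, -u, by linear_combination -huv'⟩⟩
  | one => exact ⟨1, by simp⟩
  | mul s t _ _ hs ht =>
    obtain ⟨u, hu⟩ := hs
    obtain ⟨v, hv⟩ := ht
    refine ⟨u * v, ?_⟩
    have : ((u * v : ℤ) : ℤ[X]) * (s * t) - 1 = u * s * (v * t - 1) + (u * s - 1) := by
      push_cast; ring
    rw [this]
    exact add_mem (Ideal.mul_mem_left _ _ hv) hu

theorem hasIntResidues_R₂ (hp : p.Prime) (h2 : p ≠ 2) :
    HasIntResidues p (algebraMap ℤ[X] R₂ (X + 1)) := by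
  intro r
  have hmap : ∀ f ∈ Ideal.span {(p : ℤ[X]), X + 1}, algebraMap ℤ[X] R₂ f ∈
      Ideal.span {(p : R₂), algebraMap ℤ[X] R₂ (X + 1)} := fun f hf => by
    have := Ideal.mem_map_of_mem (algebraMap ℤ[X] R₂) hf
    rwa [Ideal.map_span, Set.image_pair, map_natCast] at this
  obtain ⟨⟨f, s⟩, hs⟩ := IsLocalization.surj R₂Denom r
  obtain ⟨u, hu⟩ := exists_mul_sub_one_mem hp h2 s.2
  obtain ⟨n, hn⟩ := hasIntResidues_X_add_one p f
  -- For `r = f / s`, with `n` the residue of `f` and `u` an inverse of `s`, the residue of `r` is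
  -- `u n`.
  refine ⟨u * n, ?_⟩
  have h1 := hmap _ hu
  have h3 := hmap _ hn
  rw [map_sub, map_mul, map_one, map_intCast] at h1
  rw [map_sub, map_intCast] at h3
  have : r - ((u * n : ℤ) : R₂) =
      (-r) * (u * algebraMap ℤ[X] R₂ s - 1) + u * (algebraMap ℤ[X] R₂ f - n) := by
    simp only at hs
    push_cast
    linear_combination (u : R₂) * hs
  rw [this]
  exact add_mem (Ideal.mul_mem_left _ _ h1) (Ideal.mul_mem_left _ _ h3)

theorem natCard_P₁'_one (hp : p.Prime) (h2 : p ≠ 2) : Nat.card (P₁' p 1) = p := by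
  rw [← Nat.card_eq_of_bijective _ (mkLinearMap_P₁_bijective p 1 hp h2), natCard_P₁_one]

theorem natCast_smul_P₁'_one (hp : p.Prime) (h2 : p ≠ 2) (q : P₁' p 1) : (p : R₂) • q = 0 := by
  obtain ⟨q, rfl⟩ := (mkLinearMap_P₁_bijective p 1 hp h2).2 q
  rw [← map_natCast (algebraMap ℤ[X] R₂), algebraMap_smul, ← map_smul, natCast_smul_P₁_one,
    map_zero]

theorem algebraMap_smul_P₁'_one (hp : p.Prime) (h2 : p ≠ 2) (q : P₁' p 1) :
    algebraMap ℤ[X] R₂ (X + 1) • q = 0 := by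
  obtain ⟨q, rfl⟩ := (mkLinearMap_P₁_bijective p 1 hp h2).2 q
  rw [algebraMap_smul, ← map_smul, X_add_one_smul_P₁_one, map_zero]

end R₂

/-! ### Modules of minimal order and the final statement -/

theorem IsPrimaryCocyclic.torsionFiltration_eq_top {R Q : Type*} [CommRing R] [AddCommGroup Q]
    [Module R Q] [Finite Q] {p : ℕ} {b : R} (hQ : IsPrimaryCocyclic p b Q) (hp : p.Prime) {k : ℕ}
    (hk : 1 ≤ k) (hk3 : k ≤ 3) (hgen : k ≤ gen R Q) (hcard : Nat.card Q = p ^ (k * (k + 1) / 2)) :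
    torsionFiltration (p : R) b Q k = ⊤ := by
  apply eq_top_of_natCard_eq
  rw [hcard]
  interval_cases k
  · rw [hQ.3]; simp
  · exact natCard_torsionFiltration_two hp hcard hQ.1 hQ.2 hQ.3 hgen
  · exact natCard_torsionFiltration_three hp hcard hQ.1 hQ.2 hQ.3 hgen

/-- A cocyclic module with `k ≤ 3` generators and the least possible number of elements is
isomorphic to the `k`-th step of the socle series of `ℤ_{p^∞}[x⁻¹]`. -/
theorem IsPrimaryCocyclic.nonempty_equiv_of_natCard_eq {Q : Type*} [AddCommGroup Q] [Module ℤ[X] Q]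
    {p : ℕ} (hQ : IsPrimaryCocyclic p (X : ℤ[X]) Q) (hp : p.Prime) {k : ℕ} (hk : 1 ≤ k)
    (hk3 : k ≤ 3) (hgen : k ≤ gen ℤ[X] Q)
    (hcard : ENat.card Q = ((p ^ (k * (k + 1) / 2) : ℕ) : ℕ∞)) :
    Nonempty (Q ≃ₗ[ℤ[X]] socleSeries ℤ[X] (PrueferDividedPowers p) k) := by
  obtain ⟨hfin, hcard'⟩ := natCard_eq_of_enatCard_eq hcard
  exact hQ.nonempty_equiv hp (hQ.torsionFiltration_eq_top hp hk hk3 hgen hcard') hcard'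

end CocyclicModules

theorem mainTheorem8 (p : ℕ) (hp : p.Prime) :
    -- `ℤ[x]`-modules with socle `P₁`
    (∀ (Q : Type*) [AddCommGroup Q] [Module ℤ[X] Q] [Module.Finite ℤ[X] Q],
      IsCocyclic ℤ[X] Q → Nonempty (socle ℤ[X] Q ≃ₗ[ℤ[X]] P p 1) →
        (gen ℤ[X] Q = 1 →
          (p : ℕ∞) ≤ ENat.card Q ∧
          (ENat.card Q = p →
            Nonempty (Q ≃ₗ[ℤ[X]] socleSeries ℤ[X] (PrueferDividedPowers p) 1) ∧
            Nonempty (socleSeries ℤ[X] (PrueferDividedPowers p) 1 ≃ₗ[ℤ[X]] P p 1))) ∧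
        (gen ℤ[X] Q = 2 →
          (p : ℕ∞) ^ 3 ≤ ENat.card Q ∧
          (ENat.card Q = (p : ℕ∞) ^ 3 →
            Nonempty (Q ≃ₗ[ℤ[X]] socleSeries ℤ[X] (PrueferDividedPowers p) 2) ∧
            Nonempty (socleSeries ℤ[X] (PrueferDividedPowers p) 2 ≃ₗ[ℤ[X]] P p 2))) ∧
        (gen ℤ[X] Q = 3 →
          (p : ℕ∞) ^ 6 ≤ ENat.card Q ∧
          (ENat.card Q = (p : ℕ∞) ^ 6 →
            ¬ Nonempty (Q ≃ₗ[ℤ[X]] socleSeries ℤ[X] (PrueferDividedPowers p) 3) →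
            HasSocleLength ℤ[X] Q 4)) ∧
        (4 ≤ gen ℤ[X] Q → (p : ℕ∞) ^ 7 ≤ ENat.card Q)) ∧
    -- `ℤ[x]`-modules with socle `P₁,₁`
    (∀ (Q : Type*) [AddCommGroup Q] [Module ℤ[X] Q] [Module.Finite ℤ[X] Q],
      IsCocyclic ℤ[X] Q → Nonempty (socle ℤ[X] Q ≃ₗ[ℤ[X]] P₁ p 1) →
        (3 ≤ gen ℤ[X] Q → (p : ℕ∞) ^ 6 ≤ ENat.card Q) ∧
        (4 ≤ gen ℤ[X] Q → (p : ℕ∞) ^ 7 ≤ ENat.card Q)) ∧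
    -- `R₂`-modules with socle `P'₁,₁`
    (p ≠ 2 → ∀ (Q : Type*) [AddCommGroup Q] [Module R₂ Q] [Module.Finite R₂ Q],
      IsCocyclic R₂ Q → Nonempty (socle R₂ Q ≃ₗ[R₂] P₁' p 1) →
        (3 ≤ gen R₂ Q → (p : ℕ∞) ^ 6 ≤ ENat.card Q) ∧
        (4 ≤ gen R₂ Q → (p : ℕ∞) ^ 7 ≤ ENat.card Q)) := by
  refine ⟨fun Q _ _ _ hQ ⟨e⟩ => ?_, fun Q _ _ _ hQ ⟨e⟩ => ?_, fun h2 Q _ _ _ hQ ⟨e⟩ => ?_⟩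
  · have hQ' := hQ.isPrimaryCocyclic hp (hasIntResidues_X p) e natCast_smul_P_one X_smul_P_one
      (natCard_P_one p)
    refine ⟨fun hk => ⟨hQ'.prime_le, fun hc => ⟨?_, ?_⟩⟩,
      fun hk => ⟨hQ'.prime_pow_three_le hp hk.ge, fun hc => ⟨?_, ?_⟩⟩,
      -- Order `p ^ 6` always forces an isomorphism with `S₃(N)`, so the assumption `hne` is
      -- contradictory and no socle length is computed.
      fun hk => ⟨hQ'.prime_pow_six_le hp hk.ge, fun hc hne => absurd ?_ hne⟩,
      hQ'.prime_pow_seven_le hp⟩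
    · exact hQ'.nonempty_equiv_of_natCard_eq hp le_rfl (by norm_num) hk.ge (by simpa using hc)
    · exact ((isPrimaryCocyclic_P_one p).nonempty_equiv hp (torsionFiltration_P_one p)
        (by rw [natCard_P_one]; simp)).map LinearEquiv.symm
    · exact hQ'.nonempty_equiv_of_natCard_eq hp (by norm_num) (by norm_num) hk.ge (by simpa using hc)
    · exact ((isPrimaryCocyclic_P_two hp).nonempty_equiv hp (torsionFiltration_P_two p)
        (natCard_P_two p)).map LinearEquiv.symm
    · exact hQ'.nonempty_equiv_of_natCard_eq hp (by norm_num) le_rfl hk.ge (by simpa using hc)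
  -- On `P₁,₁` the variable acts as `-1`, so `x + 1` plays the role of `b`.
  · have hQ' := hQ.isPrimaryCocyclic hp (hasIntResidues_X_add_one p) e natCast_smul_P₁_one
      X_add_one_smul_P₁_one (natCard_P₁_one p)
    exact ⟨hQ'.prime_pow_six_le hp, hQ'.prime_pow_seven_le hp⟩
  · have : IsNoetherianRing R₂ := IsLocalization.isNoetherianRing R₂Denom R₂ inferInstance
    have hQ' := hQ.isPrimaryCocyclic hp (hasIntResidues_R₂ hp h2) e (natCast_smul_P₁'_one hp h2)
      (algebraMap_smul_P₁'_one hp h2) (natCard_P₁'_one hp h2)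
    exact ⟨hQ'.prime_pow_six_le hp, hQ'.prime_pow_seven_le hp⟩
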